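/- **Network.** A server holding $m$ files $W_1,\dots,W_m$ of $F$ bits serves $n\ge1$ users over a noiseless shared link. A caching scheme consists of caching functions giving each user $u$ a cache content $Z_u$ of at most $MF$ bits as a function of the library ($M>0$ real), a variable-length binary encoder $X$ of the library and the request matrix, and decoders. Each user makes $L\ge 1$ requests; all $nL$ requests are independent (repetitions allowed) with distribution $\mathbf q$, here the Zipf distribution $q_f=f^{-\alpha}/\sum_{i=1}^m i^{-\alpha}$, $0<\alpha<1$. Every user decodes its requested files from $X$, its cache and the request matrix. The rate of a scheme is $R^{(F)}=\sup_W \mathbb E[\mathrm{length}(X)]/F$ and its error probability is $\sup_W \mathbb P(\text{some user decodes wrongly})$, where randomness is over the requests. A number $r$ is achievable if there are schemes for $F=1,2,\dots$ with error probability tending to $0$ and $\limsup_F R^{(F)}\le r$; $R^*(n,m,M,L,\mathbf q)$ is the infimum of the achievable rates. **UP-GCLC.** Split each file into $B$ packets. Each user independently caches, for each file, a uniformly random set of $\lfloor MB/m\rfloor$ of its packets; let $C$ be the resulting cache configuration. For a request matrix, the conflict graph has as vertices the pairs $v=(\text{packet }\rho(v),\text{user }\mu(v))$ such that the packet belongs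 to a file requested by the user and is not cached by it, and a directed edge $v\to w$ if $\rho(w)\ne\rho(v)$ and $\rho(w)$ is not cached by $\mu(v)$. For a colouring of the vertices, the local number of colours is the maximum over $v$ of the number of colours in the closed out-neighbourhood of $v$. GCLC takes, of two colourings, the one with fewer local colours: (1) repeatedly pick a remaining vertex $v$, scan the other remaining vertices and add to the class of $v$ each one that has no edge in either direction to the current class and has the same label as $v$, where the label of a vertex is the set consisting of its user and all the users that cache its packet; give the class a new colour and remove it; (2) colour each vertex by its packet. The picks and scans are in an arbitrary order. Let $\chi$ be the local number of colours obtained; the codeword is $\sum \omega_{\rho}\,\mathbf a_{j}$, over the distinct pairs (packet $\rho$, colour $j$) that occur at vertices, where $\omega_\rho$ is the packet as a symbol of $\mathbb F_{2^{F/B}}$ and the $\mathbf a_j$ of length $\chi$ are the columns of a generator matrix of an MDS code. Its rate for the configuration $C$ is $R_B(C)=\mathbb E[\chi]/B$ (expectation over the requests). The rate $R^{\rm UP\text{-}GCLC}(n,m,M,L,\mathbf q)$ as $B\to\infty$ is the infimum of all $r$ such that $\lim_{B\to\infty}\mathbb P_C(R_B(C)\le r+\delta)=1$ for all $\delta>0$.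 **Theorem.** Let $0<\alpha<1$ and $\varepsilon>0$, let $\mathbf q$ be the Zipf distribution with parameter $\alpha$, and let the order in which GCLC picks and scans the vertices be arbitrary. 1. Whenever $n,L\ge1$ and $0<M\le(1-\varepsilon)m$, for every $B\ge1$ and every possible cache configuration $C$, and for all sufficiently large $F/B$, there are an MDS matrix for every request matrix and decoders such that this is a caching scheme with error probability $0$ and with rate $R_B(C)$. 2. Whenever $n,L\ge1$ and $0<M\le(1-\varepsilon)m$, for all $\delta>0$, $$\lim_{B\to\infty}\mathbb P_C\Big(R_B(C)\le \min\Big\{L\Big(\frac mM-1\Big),\,Ln,\,m-M\Big\}+\delta\Big)=1,$$ that is, $R^{\rm UP\text{-}GCLC}(n,m,M,L,\mathbf q)\le\min\{L(\frac mM-1),Ln,m-M\}$. 3. UP-GCLC and this upper bound are order-optimal: there is a constant $1\le\nu<\infty$, depending only on $\alpha$ and $\varepsilon$, such that for all functions $n,L,M$ of $m$ with $n(m)\to\infty$, $L\ge1$ and $0<M\le(1-\varepsilon)m$, $$\limsup_{m\to\infty}\frac{R^{\rm UP\text{-}GCLC}(n,m,M,L,\mathbf q)}{R^*(n,m,M,L,\mathbf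 q)}\le\nu,\qquad \limsup_{m\to\infty}\frac{\min\{L(\frac mM-1),Ln,m-M\}}{R^*(n,m,M,L,\mathbf q)}\le\nu .$$ -/

import Mathlib

open Filter Topology
open scoped ENNReal

namespace CodedCaching

/-! ## The shared link caching network -/

/-- A library of `m` files of `F` bits each. -/
abbrev Library (m F : ℕ) : Type := Fin m → Fin F → ZMod 2

/-- A request matrix: `d u l` is the `l`-th file requested by user `u`. -/
abbrev Demand (n m L : ℕ) : Type := Fin n → Fin L → Fin m

/-- A caching scheme for `n` users, `m` files of `F` bits, `L` requests per user, and caches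
of `cap` bits. -/
structure CachingScheme (n m L F cap : ℕ) where
  /-- the caching functions -/
  cache : Fin n → Library m F → (Fin cap → ZMod 2)
  /-- the variable-length multicast encoder -/
  encode : Library m F → Demand n m L → List (ZMod 2)
  /-- the decoding functions -/
  decode : Fin n → List (ZMod 2) → (Fin cap → ZMod 2) → Demand n m L → (Fin L → Fin F → ZMod 2)

/-- The probability of a request matrix whose `n * L` entries are drawn independently
from `q`. -/
noncomputable def demandProb {n m L : ℕ} (q : Fin m → ℝ) (d : Demand n m L) : ℝ :=
  ∏ u, ∏ l, q (d u l)

namespace CachingScheme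

variable {n m L F cap : ℕ}

/-- The rate: the expected codeword length in file units, for the worst library. -/
noncomputable def rate (S : CachingScheme n m L F cap) (q : Fin m → ℝ) : ℝ≥0∞ :=
  ⨆ W : Library m F,
    ENNReal.ofReal ((∑ d : Demand n m L, demandProb q d * ((S.encode W d).length : ℝ)) / F)

open Classical in
/-- The probability, for the worst library, that some user decodes wrongly. -/
noncomputable def errorProb (S : CachingScheme n m L F cap) (q : Fin m → ℝ) : ℝ :=
  ⨆ W : Library m F, ∑ d : Demand n m L,
    if ∃ u, S.decode u (S.encode W d) (S.cache u W) d ≠ fun l => W (d u l)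
    then demandProb q d else 0

end CachingScheme

/-- Achievable rates, for cache capacity `M` files. -/
def IsAchievable (n m L : ℕ) (M : ℝ) (q : Fin m → ℝ) (r : ℝ≥0∞) : Prop :=
  ∃ S : ∀ F : ℕ, CachingScheme n m L F ⌊M * F⌋₊,
    Tendsto (fun F => (S F).errorProb q) atTop (𝓝 0) ∧
    limsup (fun F => (S F).rate q) atTop ≤ r

/-- The infimum `R*` of the achievable rates. -/
noncomputable def optimalRate (n m L : ℕ) (M : ℝ) (q : Fin m → ℝ) : ℝ≥0∞ :=
  sInf {r | IsAchievable n m L M q r}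

/-- The Zipf distribution; the file of rank `f + 1` has index `f`. -/
noncomputable def zipf (α : ℝ) (m : ℕ) (f : Fin m) : ℝ :=
  ((f : ℕ) + 1 : ℝ) ^ (-α) / ∑ i : Fin m, ((i : ℕ) + 1 : ℝ) ^ (-α)

/-! ## Random caching placement -/

/-- A packet-level cache configuration, each file being split into `B` packets:
`C u f` is the set of packets of file `f` cached by user `u`. -/
abbrev CacheConfig (n m B : ℕ) : Type := Fin n → Fin m → Finset (Fin B)

/-- The configurations in which every user caches exactly `p f * M * B` (rounded down)
packets of every file `f`. -/
abbrev Placement (n m : ℕ) (M : ℝ) (p : Fin m → ℝ) (B : ℕ) : Type :=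
  {C : CacheConfig n m B // ∀ u f, (C u f).card = ⌊p f * M * B⌋₊}

/-- The probability of an event when all the sets `C u f` are chosen independently and
uniformly among those of the prescribed size, that is, when the placement is uniform. -/
noncomputable def placementProb {n m : ℕ} {M : ℝ} {p : Fin m → ℝ} {B : ℕ}
    (E : Placement n m M p B → Prop) : ℝ :=
  (Nat.card {C : Placement n m M p B // E C} : ℝ) / (Nat.card (Placement n m M p B) : ℝ)

/-- The uniform caching distribution. -/
noncomputable def uniformCaching (m : ℕ) (_ : Fin m) : ℝ := 1 / (m : ℝ)

/-! ## The conflict graph and greedy constrained local colouring -/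

/-- A packet is a pair (file, index of the packet in the file). -/
abbrev Packet (m B : ℕ) : Type := Fin m × Fin B

/-- A (potential) vertex of the conflict graph: a packet `v.1` and a user `v.2` who wants it. -/
abbrev Vertex (n m B : ℕ) : Type := Packet m B × Fin n

section Colouring

variable {n m L B : ℕ} (C : CacheConfig n m B)

/-- User `u` has the packet `x` in its cache. -/
abbrev Cached (u : Fin n) (x : Packet m B) : Prop := x.2 ∈ C u x.1

/-- The pairs (packet, user) such that the packet belongs to a file requested by the user and
is not in the cache of the user: the vertices of the conflict graph. -/
abbrev IsWanted (d : Demand n m L) (v : Vertex n m B) : Prop :=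
  (∃ l, d v.2 l = v.1.1) ∧ ¬ Cached C v.2 v.1

/-- The vertex set of the conflict graph. -/
def vertices (d : Demand n m L) : Finset (Vertex n m B) :=
  Finset.univ.filter (IsWanted C d)

/-- There is a directed edge from `v` to `w`: the packet of `w` interferes with `v`. -/
abbrev Edge (v w : Vertex n m B) : Prop := ¬ Cached C v.2 w.1 ∧ w.1 ≠ v.1

/-- The users who request the packet of `v` as this vertex, or cache it. -/
def userLabel (v : Vertex n m B) : Finset (Fin n) :=
  insert v.2 (Finset.univ.filter fun u => Cached C u v.1)

/-- The closed out-neighbourhood in the conflict graph. -/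
def closedOutNbhd (d : Demand n m L) (v : Vertex n m B) : Finset (Vertex n m B) :=
  (vertices C d).filter fun w => w = v ∨ Edge C v w

/-- The largest number of colours in a closed out-neighbourhood. -/
def localColours (d : Demand n m L) (c : Vertex n m B → ℕ) : ℕ :=
  (vertices C d).sup fun v => ((closedOutNbhd C d v).image c).card

/-- Two vertices that the first colouring rule lets share a colour: no edge in either
direction, and equal labels. -/
abbrev Compatible (v w : Vertex n m B) : Prop :=
  ¬ Edge C v w ∧ ¬ Edge C w v ∧ userLabel C v = userLabel C w

end Colouring

/-- Scan a list, adding to `I` each element that is compatible with all of the current `I`. -/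
def greedyClass {V : Type} (ok : V → V → Prop) [DecidableRel ok] (I : List V) :
    List V → List V
  | [] => I
  | w :: l => if ∀ v ∈ I, ok v w then greedyClass ok (I ++ [w]) l else greedyClass ok I l

/-- Greedy colouring: as long as vertices are left, take the first one, complete it greedily
to a class, give this class a new colour and remove it. The list of the colour classes is
returned. -/
def greedyClasses {V : Type} [DecidableEq V] (ok : V → V → Prop) [DecidableRel ok] :
    List V → List (List V)
  | [] => []
  | v :: l =>
    greedyClass ok [v] l ::
      greedyClasses ok (l.filter fun w => decide (w ∉ greedyClass ok [v] l))
termination_by l => l.length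
decreasing_by
  rw [List.length_unattach, List.length_cons]
  exact Nat.lt_succ_of_le ((List.length_filter_le _ _).trans_eq List.length_attach)

/-- The colour of a vertex is the position of its class. -/
def colourOf {V : Type} [DecidableEq V] (classes : List (List V)) (v : V) : ℕ :=
  classes.findIdx fun I => decide (v ∈ I)

/-- A rule for the arbitrary choices of the greedy algorithm: for every cache configuration
and every request matrix, an enumeration of all the pairs (packet, user). -/
structure ScanOrder (n m L : ℕ) where
  /-- the enumeration -/
  list : ∀ B : ℕ, CacheConfig n m B → Demand n m L → List (Vertex n m B)
  nodup : ∀ B C d, (list B C d).Nodup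
  complete : ∀ B C d v, v ∈ list B C d

section GCLC

variable {n m L B : ℕ} (o : ScanOrder n m L) (C : CacheConfig n m B) (d : Demand n m L)

/-- The vertices of the conflict graph in the order of the scan. -/
def scan : List (Vertex n m B) :=
  (o.list B C d).filter fun v => decide (IsWanted C d v)

/-- The first colouring: classes of pairwise non-adjacent vertices with the same label. -/
def classes₁ : List (List (Vertex n m B)) := greedyClasses (Compatible C) (scan o C d)

/-- The second colouring: the vertices with the same packet form a class. -/
def classes₂ : List (List (Vertex n m B)) := greedyClasses (fun v w => v.1 = w.1) (scan o C d)

/-- The classes of the colouring selected by greedy constrained local colouring: the one of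
the two with fewer local colours. -/
def gclcClasses : List (List (Vertex n m B)) :=
  if localColours C d (colourOf (classes₁ o C d)) ≤ localColours C d (colourOf (classes₂ o C d))
  then classes₁ o C d else classes₂ o C d

/-- The number of packet transmissions of greedy constrained local colouring. -/
def gclcLength : ℕ := localColours C d (colourOf (gclcClasses o C d))

/-- The rate of the delivery by greedy constrained local colouring for the cache
configuration `C`: the expected number of packet transmissions, in file units. -/
noncomputable def gclcRate (q : Fin m → ℝ) : ℝ :=
  (∑ d : Demand n m L, demandProb q d * (gclcLength o C d : ℝ)) / B

end GCLC

/-! ## The linear code -/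

/-- The columns `0, …, N - 1` of `A` generate an MDS code with `ν` message symbols: any `ν` of
them are linearly independent. -/
def IsMDS {K : Type} [Field K] {ν : ℕ} (N : ℕ) (A : Matrix (Fin ν) ℕ K) : Prop :=
  ∀ T : Finset ℕ, T ⊆ Finset.range N → T.card = ν →
    LinearIndependent K fun (j : T) (i : Fin ν) => A i j

/-- The `b`-th of the `B` packets, of `k` bits each, of file `f`. -/
def packetBits {m B k : ℕ} (W : Library m (B * k)) (x : Packet m B) : Fin k → ZMod 2 :=
  fun i => W x.1 (finProdFinEquiv (x.2, i))

/-- The bit string of a vector of symbols of `GaloisField 2 k`. -/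
noncomputable def toBits {k ν : ℕ} (e : (Fin k → ZMod 2) ≃ₗ[ZMod 2] GaloisField 2 k)
    (x : Fin ν → GaloisField 2 k) : List (ZMod 2) :=
  (List.ofFn fun i => List.ofFn (e.symm (x i))).flatten

/-- The scheme `S` has cache configuration `C` and uses the index code of greedy
constrained local colouring: the codeword is the sum of the requested packets, as symbols of
`GaloisField 2 k`, times the columns of an MDS generator matrix that belong to their
colours. Vertices with the same packet and the same colour count once. -/
structure IsGCLCScheme {n m L B k cap : ℕ} (o : ScanOrder n m L) (C : CacheConfig n m B)
    (S : CachingScheme n m L (B * k) cap) : Prop where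
  caches : ∀ u W W', S.cache u W = S.cache u W' ↔
    ∀ x : Packet m B, Cached C u x → packetBits W x = packetBits W' x
  delivers : ∃ e : (Fin k → ZMod 2) ≃ₗ[ZMod 2] GaloisField 2 k, ∀ d : Demand n m L,
    ∃ A : Matrix (Fin (gclcLength o C d)) ℕ (GaloisField 2 k),
      IsMDS (gclcClasses o C d).length A ∧
      ∀ W, S.encode W d = toBits e fun i =>
        ∑ y ∈ (vertices C d).image (fun v => (v.1, colourOf (gclcClasses o C d) v)),
          e (packetBits W y.1) * A i y.2

/-! ## The rate as the number of packets tends to infinity -/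

/-- As `B → ∞`, the rate of RAP-GCLC with caching distribution `p` is asymptotically at most `r`,
in probability over the random placement. -/
def RateAtMost {n m L : ℕ} (o : ScanOrder n m L) (M : ℝ) (q p : Fin m → ℝ) (r : ℝ≥0∞) : Prop :=
  ∀ δ : ℝ, 0 < δ → Tendsto
    (fun B : ℕ => placementProb fun C : Placement n m M p B =>
      ENNReal.ofReal (gclcRate o C.1 q) ≤ r + ENNReal.ofReal δ)
    atTop (𝓝 1)

/-- The rate of UP-GCLC as `B → ∞`: the least asymptotic upper bound in probability. -/
noncomputable def upGclcRate {n m L : ℕ} (o : ScanOrder n m L) (M : ℝ) (q : Fin m → ℝ) : ℝ≥0∞ :=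
  sInf {r | RateAtMost o M q (uniformCaching m) r}

/-- The upper bound `min {L (m / M - 1), L n, m - M}`. -/
noncomputable def rateBound (n m L : ℕ) (M : ℝ) : ℝ :=
  min ((L : ℝ) * ((m : ℝ) / M - 1)) (min ((L : ℝ) * n) ((m : ℝ) - M))

end CodedCaching

namespace CodedCaching

/-! ## The greedy colouring -/

section Greedy

variable {V : Type} (ok : V → V → Prop) [DecidableRel ok]

/-! Decoding. If two libraries give the same codeword and agree on a user's cache, let `D` be the
difference of their packets and `v` a wanted vertex of that user. In the relation `∑ D ρ • a j = 0`,
every other packet is either cached, so that its term vanishes, or belongs to an out-neighbour of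
`v`, whose colour is one of at most `χ - 1` local colours different from that of `v`. So `D v.1`
times the sum of the columns attached to this packet lies in the span of fewer than `χ` columns. One
packet may carry several colours, so columns are needed for which such a sum also avoids the span
(`IsGeneric`); they exist over large fields (`exists_isGeneric`), and `codeword_determines`
concludes.

Upper bound. Colouring by packets needs at most `B - K` local colours per requested file, where `K`
is the number of packets of a file in a cache; this yields `L n` and `m - M`. For the other
colouring, maximality of the greedy classes shows that the colours with label `U` all occur at a
single user, so there are at most `L` times as many as packets of one file cached exactly by `U`
minus this user (`card_image_userLabel_le`). By Chebyshev that number is about `B * a ^ (|U| - 1) *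
(1 - a) ^ (n - |U| + 1)` with `a = K / B`, simultaneously for all files and sets. Summing over
nonempty `U` gives at most `1 / a - 1`, which tends to `m / M - 1`.

Converse. Over `t` independent request rounds with fixed caches, the codewords and the caches of `s`
users determine every file these users request. Counting libraries and averaging over requests
bounds the rate below by (expected number of distinct files `- s M`) `/ (2 t)`
(`IsAchievable.cutset`). As `α < 1`, each file has probability at least `(1 - α) / m`, so order `m`
requests reach all but a fraction `ε / 2` of the files in expectation, while `s M ≤ (1 - ε) m`.
Taking `s` as large as `n` and `(1 - ε) m / M` allow gives the constant ratio
(`rateBound_le_gapConstant_mul`). -/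

theorem subset_greedyClass (I l : List V) {v : V} (hv : v ∈ I) : v ∈ greedyClass ok I l := by
  induction l generalizing I with
  | nil => exact hv
  | cons w l ih =>
    unfold greedyClass
    split_ifs
    · exact ih _ (List.mem_append_left _ hv)
    · exact ih _ hv

theorem greedyClass_subset (I l : List V) {v : V} (hv : v ∈ greedyClass ok I l) :
    v ∈ I ∨ v ∈ l := by
  induction l generalizing I with
  | nil => exact Or.inl hv
  | cons w l ih =>
    unfold greedyClass at hv
    split_ifs at hv
    · rcases ih _ hv with h | h
      · rcases List.mem_append.1 h with h | h
        · exact Or.inl h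
        · exact Or.inr (by simp_all)
      · exact Or.inr (List.mem_cons_of_mem _ h)
    · exact (ih _ hv).imp_right (List.mem_cons_of_mem _)

theorem greedyClass_pairwise (hr : ∀ v, ok v v) (hs : ∀ v w, ok v w → ok w v) (I l : List V)
    (hI : ∀ v ∈ I, ∀ w ∈ I, ok v w) :
    ∀ v ∈ greedyClass ok I l, ∀ w ∈ greedyClass ok I l, ok v w := by
  induction l generalizing I with
  | nil => exact hI
  | cons x l ih =>
    unfold greedyClass
    split_ifs with h
    · refine ih _ fun v hv w hw => ?_
      simp only [List.mem_append, List.mem_singleton] at hv hw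
      rcases hv with hv | rfl <;> rcases hw with hw | rfl
      · exact hI v hv w hw
      · exact h v hv
      · exact hs _ _ (h w hw)
      · exact hr _
    · exact ih _ hI

/-- An element is rejected because of a member present when it is scanned, and members are never
removed. -/
theorem greedyClass_maximal (I l : List V) {x : V} (hx : x ∈ l)
    (hxI : x ∉ greedyClass ok I l) : ∃ y ∈ greedyClass ok I l, ¬ ok y x := by
  induction l generalizing I with
  | nil => simp at hx
  | cons w l ih =>
    unfold greedyClass at hxI ⊢
    split_ifs at hxI ⊢ with h
    · rcases List.mem_cons.1 hx with rfl | hx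
      · exact absurd (subset_greedyClass ok _ _ (by simp)) hxI
      · exact ih _ hx hxI
    · rcases List.mem_cons.1 hx with rfl | hx
      · push Not at h
        obtain ⟨v, hv, hvx⟩ := h
        exact ⟨v, subset_greedyClass ok _ _ hv, hvx⟩
      · exact ih _ hx hxI

variable [DecidableEq V]

theorem colourOf_cons (I : List V) (Is : List (List V)) (v : V) :
    colourOf (I :: Is) v = if v ∈ I then 0 else colourOf Is v + 1 := by
  unfold colourOf
  rw [List.findIdx_cons]
  by_cases h : v ∈ I <;> simp [h]

/-- The greedy colouring is proper and maximal. -/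
theorem greedyClasses_spec (hr : ∀ v, ok v v) (hs : ∀ v w, ok v w → ok w v) (l : List V) :
    (∀ x ∈ l, colourOf (greedyClasses ok l) x < (greedyClasses ok l).length) ∧
    (∀ x ∈ l, ∀ y ∈ l,
      colourOf (greedyClasses ok l) x = colourOf (greedyClasses ok l) y → ok x y) ∧
    (∀ x ∈ l, ∀ i < colourOf (greedyClasses ok l) x,
      ∃ y ∈ l, colourOf (greedyClasses ok l) y = i ∧ ¬ ok y x) := by
  induction hn : l.length using Nat.strong_induction_on generalizing l with
  | _ n ih =>
  subst hn
  rcases l with _ | ⟨v, l⟩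
  · simp
  rw [greedyClasses]
  set G := greedyClass ok [v] l with hG
  set l' := l.filter fun w => decide (w ∉ G) with hl'
  have hlen : l'.length < (v :: l).length :=
    Nat.lt_succ_of_le (List.length_filter_le _ _)
  obtain ⟨h1, h2, h3⟩ := ih _ hlen l' rfl
  have hv : v ∈ G := subset_greedyClass ok _ _ (by simp)
  have hmem : ∀ x ∈ v :: l, x ∉ G → x ∈ l' := by
    intro x hx hxG
    rcases List.mem_cons.1 hx with rfl | hx
    · exact absurd hv hxG
    · simp [hl', hx, hxG]
  have hGl : ∀ x ∈ G, x ∈ v :: l := by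
    intro x hx
    rcases greedyClass_subset ok _ _ hx with h | h
    · simp_all
    · exact List.mem_cons_of_mem _ h
  have hl'l : ∀ x ∈ l', x ∈ v :: l ∧ x ∉ G := by
    intro x hx
    rw [hl', List.mem_filter] at hx
    exact ⟨List.mem_cons_of_mem _ hx.1, by simpa using hx.2⟩
  refine ⟨fun x hx => ?_, fun x hx y hy => ?_, fun x hx i hi => ?_⟩
  · rw [colourOf_cons, List.length_cons]
    split_ifs with h
    · exact Nat.succ_pos _
    · exact Nat.succ_lt_succ (h1 x (hmem x hx h))
  · rw [colourOf_cons, colourOf_cons]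
    split_ifs with h h' h'
    · intro _
      exact greedyClass_pairwise ok hr hs [v] l (by simpa using hr v) x h y h'
    · exact False.elim
    · exact False.elim
    · intro h4
      exact h2 x (hmem x hx h) y (hmem y hy h') (by omega)
  · rw [colourOf_cons] at hi
    split_ifs at hi with h
    · omega
    -- Colour `0` is the class just built, and its maximality supplies the obstruction; larger
    -- colours come from the recursive call, shifted by one.
    · rcases i with _ | i
      · have hxl : x ∈ l := by
          rcases List.mem_cons.1 hx with rfl | hx
          · exact absurd hv h
          · exact hx
        obtain ⟨y, hy, hyx⟩ := greedyClass_maximal ok [v] l hxl h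
        exact ⟨y, hGl y hy, by rw [colourOf_cons, if_pos hy], hyx⟩
      · obtain ⟨y, hy, hyi, hyx⟩ := h3 x (hmem x hx h) i (by omega)
        refine ⟨y, (hl'l y hy).1, ?_, hyx⟩
        rw [colourOf_cons, if_neg (hl'l y hy).2, hyi]

end Greedy

/-! ## The two colourings of the conflict graph -/

section Colourings

variable {n m L B : ℕ} (o : ScanOrder n m L) (C : CacheConfig n m B) (d : Demand n m L)

theorem mem_vertices {v : Vertex n m B} : v ∈ vertices C d ↔ IsWanted C d v := by
  simp [vertices]

theorem mem_scan {v : Vertex n m B} : v ∈ scan o C d ↔ v ∈ vertices C d := by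
  simp [vertices, scan, o.complete]

theorem classes₁_spec :
    (∀ x ∈ vertices C d, colourOf (classes₁ o C d) x < (classes₁ o C d).length) ∧
    (∀ x ∈ vertices C d, ∀ y ∈ vertices C d,
      colourOf (classes₁ o C d) x = colourOf (classes₁ o C d) y → Compatible C x y) ∧
    (∀ x ∈ vertices C d, ∀ i < colourOf (classes₁ o C d) x,
      ∃ y ∈ vertices C d, colourOf (classes₁ o C d) y = i ∧ ¬ Compatible C y x) := by
  have := greedyClasses_spec (Compatible C)
    (fun v => ⟨fun h => h.2 rfl, fun h => h.2 rfl, rfl⟩)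
    (fun v w h => ⟨h.2.1, h.1, h.2.2.symm⟩) (scan o C d)
  simp only [mem_scan] at this
  exact this

/-- Having the same packet is an equivalence relation, so a maximal class is a full equivalence
class. This gives the converse implication, beyond properness. -/
theorem classes₂_spec :
    (∀ x ∈ vertices C d, colourOf (classes₂ o C d) x < (classes₂ o C d).length) ∧
    (∀ x ∈ vertices C d, ∀ y ∈ vertices C d,
      colourOf (classes₂ o C d) x = colourOf (classes₂ o C d) y ↔ x.1 = y.1) := by
  obtain ⟨h1, h2, h3⟩ := greedyClasses_spec (fun v w : Vertex n m B => v.1 = w.1)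
    (fun v => rfl) (fun v w h => h.symm) (scan o C d)
  simp only [mem_scan] at h1 h2 h3
  refine ⟨h1, fun x hx y hy => ⟨h2 x hx y hy, fun hxy => ?_⟩⟩
  have key : ∀ x ∈ vertices C d, ∀ y ∈ vertices C d, x.1 = y.1 →
      ¬ colourOf (classes₂ o C d) x < colourOf (classes₂ o C d) y := by
    intro x hx y hy hxy hlt
    obtain ⟨z, hz, hzx, hne⟩ := h3 y hy _ hlt
    exact hne ((h2 z hz x hx hzx).trans hxy)
  exact le_antisymm (not_lt.1 (key y hy x hx hxy.symm)) (not_lt.1 (key x hx y hy hxy))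

/-- The colouring selected by the algorithm is proper. -/
theorem gclcClasses_spec :
    (∀ x ∈ vertices C d, colourOf (gclcClasses o C d) x < (gclcClasses o C d).length) ∧
    (∀ x ∈ vertices C d, ∀ y ∈ vertices C d,
      colourOf (gclcClasses o C d) x = colourOf (gclcClasses o C d) y → ¬ Edge C x y) := by
  unfold gclcClasses
  split_ifs
  · obtain ⟨h1, h2, -⟩ := classes₁_spec o C d
    exact ⟨h1, fun x hx y hy h => (h2 x hx y hy h).1⟩
  · obtain ⟨h1, h2⟩ := classes₂_spec o C d
    exact ⟨h1, fun x hx y hy h he => he.2 ((h2 x hx y hy).1 h).symm⟩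

theorem gclcLength_le_left :
    gclcLength o C d ≤ localColours C d (colourOf (classes₁ o C d)) := by
  unfold gclcLength gclcClasses
  split_ifs with h
  · exact le_rfl
  · omega

theorem gclcLength_le_right :
    gclcLength o C d ≤ localColours C d (colourOf (classes₂ o C d)) := by
  unfold gclcLength gclcClasses
  split_ifs with h
  · exact h
  · exact le_rfl

end Colourings

/-! ## Generic matrices -/

section Generic

variable {K : Type} [Field K] {ν : ℕ}

/-- No nonempty sum of columns lies in the span of fewer than `ν` other columns. -/
def IsGeneric (N : ℕ) (a : ℕ → Fin ν → K) : Prop :=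
  ∀ T S : Finset ℕ, T ⊆ Finset.range N → S ⊆ Finset.range N → T.card < ν → S.Nonempty →
    Disjoint S T → ∑ j ∈ S, a j ∉ Submodule.span K (a '' T)

/-- Only sums of a single column are used here; longer sums matter for packets that carry several
colours. -/
theorem IsGeneric.isMDS {N : ℕ} {a : ℕ → Fin ν → K} (h : IsGeneric N a) :
    IsMDS N (Matrix.of fun i j => a j i) := by
  intro T hT hcard
  change LinearIndependent K fun j : T => a j
  rw [linearIndependent_iff_notMem_span]
  rintro ⟨j, hj⟩ hmem
  refine h (T.erase j) {j} ((Finset.erase_subset _ _).trans hT) (by simpa using hT hj)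
    ?_ (by simp) (by simp) ?_
  · rw [Finset.card_erase_of_mem hj, hcard]
    have : 0 < T.card := Finset.card_pos.2 ⟨j, hj⟩
    omega
  · rw [Finset.sum_singleton]
    refine Submodule.span_mono ?_ hmem
    rintro _ ⟨⟨i, hi⟩, hne, rfl⟩
    exact ⟨i, by simpa [hi] using hne, rfl⟩

/-- The curve `x ↦ (x, x ^ 2, …, x ^ ν)`. -/
def momentCurve (ν : ℕ) (x : K) : Fin ν → K := fun i => x ^ ((i : ℕ) + 1)

open Polynomial in
-- A proper subspace is killed by a nonzero functional, whose value at `momentCurve ν x + w` is a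
-- polynomial in `x` of degree at most `ν`. The curve has no constant term, so `w` affects only the
-- constant coefficient and cannot make the polynomial vanish.
theorem card_momentCurve_mem_le [Fintype K] [DecidableEq K] (U : Submodule K (Fin ν → K))
    (hU : U ≠ ⊤) (w : Fin ν → K) [DecidablePred fun x : K => momentCurve ν x + w ∈ U] :
    (Finset.univ.filter fun x : K => momentCurve ν x + w ∈ U).card ≤ ν := by
  obtain ⟨f, hf, hUf⟩ := Submodule.exists_le_ker_of_lt_top U (lt_top_iff_ne_top.2 hU)
  let c : Fin ν → K := fun i => f (Pi.single i 1)
  have hfc : ∀ v, f v = ∑ i, c i * v i := by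
    intro v
    conv_lhs => rw [pi_eq_sum_univ' v]
    simp [c, map_sum, mul_comm]
  let p : K[X] := ∑ i : Fin ν, C (c i) * X ^ ((i : ℕ) + 1) + C (f w)
  have hcoeff : ∀ i : Fin ν, p.coeff ((i : ℕ) + 1) = c i := by
    intro i
    simp only [p, coeff_add, finsetSum_coeff, coeff_C_mul, coeff_X_pow, coeff_C]
    rw [Finset.sum_eq_single i]
    · simp
    · intro j _ hj
      have : (i : ℕ) ≠ j := fun h => hj (Fin.ext h.symm)
      simp [this]
    · simp
  have hp : p ≠ 0 := by
    rintro hp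
    apply hf
    ext i
    have := hcoeff i
    rw [hp, coeff_zero] at this
    simpa [c] using this.symm
  have hdeg : p.natDegree ≤ ν := by
    refine (natDegree_add_le _ _).trans (max_le ?_ (by simp))
    refine natDegree_sum_le_of_forall_le _ _ fun i _ => ?_
    refine (natDegree_C_mul_X_pow_le _ _).trans ?_
    omega
  have hsub : (Finset.univ.filter fun x : K => momentCurve ν x + w ∈ U) ⊆ p.roots.toFinset := by
    intro x hx
    rw [Finset.mem_filter] at hx
    rw [Multiset.mem_toFinset, mem_roots hp, IsRoot]
    have h0 : f (momentCurve ν x + w) = 0 := hUf hx.2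
    rw [map_add, hfc (momentCurve ν x)] at h0
    simpa [p, eval_finsetSum, momentCurve] using h0
  exact (Finset.card_le_card hsub).trans
    ((Multiset.toFinset_card_le _).trans ((card_roots' p).trans hdeg))

theorem span_image_ne_top {T : Finset ℕ} (a : ℕ → Fin ν → K) (hT : T.card < ν) :
    Submodule.span K (a '' T) ≠ ⊤ := by
  classical
  intro h
  have h1 := finrank_span_finset_le_card (R := K) (T.image a)
  rw [Set.finrank, Finset.coe_image, h, finrank_top, Module.finrank_fin_fun] at h1
  have := Finset.card_image_le (s := T) (f := a)
  omega

/-- Over a large field there are generic matrices. -/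
theorem exists_isGeneric [Fintype K] (N : ℕ) (hK : 2 * 4 ^ N * ν < Fintype.card K) :
    ∃ a : ℕ → Fin ν → K, IsGeneric N a := by
  classical
  induction N with
  | zero =>
    refine ⟨fun _ => 0, fun T S _ hS _ hne _ => ?_⟩
    obtain ⟨x, hx⟩ := hne
    simpa using hS hx
  | succ N ih =>
    obtain ⟨a, ha⟩ := ih (lt_of_le_of_lt (by gcongr <;> omega) hK)
    let P := (Finset.range N).powerset ×ˢ (Finset.range N).powerset
    -- The new column can occur in the sum (`bad₁`) or among the spanning columns (`bad₂`). In the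
    -- second case an old sum joins the span, so `card + 1 < ν` keeps the subspace proper.
    let bad₁ : Finset ℕ × Finset ℕ → Finset K := fun q =>
      Finset.univ.filter fun x =>
        momentCurve ν x + ∑ j ∈ q.2, a j ∈ Submodule.span K (a '' q.1)
    let bad₂ : Finset ℕ × Finset ℕ → Finset K := fun q =>
      Finset.univ.filter fun x =>
        momentCurve ν x + 0 ∈ Submodule.span K (insert (∑ j ∈ q.2, a j) (a '' q.1))
    let bad := (P.filter fun q => q.1.card < ν).biUnion bad₁ ∪
      (P.filter fun q => q.1.card + 1 < ν).biUnion bad₂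
    have hPcard : P.card = 4 ^ N := by
      simp only [P, Finset.card_product, Finset.card_powerset, Finset.card_range]
      rw [← mul_pow]; norm_num
    have hbad : bad.card ≤ 2 * 4 ^ N * ν := by
      refine (Finset.card_union_le _ _).trans ?_
      have e1 : ((P.filter fun q => q.1.card < ν).biUnion bad₁).card ≤ 4 ^ N * ν := by
        refine (Finset.card_biUnion_le_card_mul _ _ ν fun q hq => ?_).trans
          (Nat.mul_le_mul_right _ ((Finset.card_filter_le _ _).trans_eq hPcard))
        exact card_momentCurve_mem_le _ (span_image_ne_top a (Finset.mem_filter.1 hq).2) _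
      have e2 : ((P.filter fun q => q.1.card + 1 < ν).biUnion bad₂).card ≤ 4 ^ N * ν := by
        refine (Finset.card_biUnion_le_card_mul _ _ ν fun q hq => ?_).trans
          (Nat.mul_le_mul_right _ ((Finset.card_filter_le _ _).trans_eq hPcard))
        refine card_momentCurve_mem_le _ (fun h => ?_) _
        have h1 := finrank_span_finset_le_card (R := K)
          (insert (∑ j ∈ q.2, a j) (q.1.image a))
        rw [Set.finrank, Finset.coe_insert, Finset.coe_image, h, finrank_top,
          Module.finrank_fin_fun] at h1
        have h2 := Finset.card_insert_le (∑ j ∈ q.2, a j) (q.1.image a)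
        have h3 := Finset.card_image_le (s := q.1) (f := a)
        have h4 := (Finset.mem_filter.1 hq).2
        omega
      calc _ ≤ 4 ^ N * ν + 4 ^ N * ν := add_le_add e1 e2
        _ = _ := by ring
    obtain ⟨x, hx⟩ : ∃ x : K, x ∉ bad := by
      by_contra! h
      have : bad = Finset.univ := Finset.eq_univ_of_forall h
      rw [this, Finset.card_univ] at hbad
      have : 2 * 4 ^ N * ν ≤ 2 * 4 ^ (N + 1) * ν := by gcongr <;> omega
      omega
    simp only [bad, Finset.mem_union, Finset.mem_biUnion, Finset.mem_filter, not_or, not_exists,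
      not_and, P, Finset.mem_product, Finset.mem_powerset, bad₁, bad₂, Finset.mem_univ,
      true_and, add_zero, and_imp, Prod.forall] at hx
    obtain ⟨hx1, hx2⟩ := hx
    let b : ℕ → Fin ν → K := Function.update a N (momentCurve ν x)
    have hbN : b N = momentCurve ν x := Function.update_self _ _ _
    have hba : ∀ j ≠ N, b j = a j := fun j hj => Function.update_of_ne hj _ _
    have himg : ∀ T : Finset ℕ, N ∉ T → b '' T = a '' T := fun T hT =>
      Set.image_congr fun j hj => hba j fun h => hT (h ▸ hj)
    have hsum : ∀ S : Finset ℕ, N ∉ S → ∑ j ∈ S, b j = ∑ j ∈ S, a j := fun S hS =>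
      Finset.sum_congr rfl fun j hj => hba j fun h => hS (h ▸ hj)
    have hlow : ∀ T : Finset ℕ, T ⊆ Finset.range (N + 1) → T.erase N ⊆ Finset.range N := by
      intro T hT j hj
      rw [Finset.mem_erase] at hj
      have := Finset.mem_range.1 (hT hj.2)
      exact Finset.mem_range.2 (by omega)
    refine ⟨b, fun T S hT hS hcard hne hdisj => ?_⟩
    have hTN := hlow T hT
    have hSN := hlow S hS
    by_cases hNS : N ∈ S
    · have hNT : N ∉ T := Finset.disjoint_left.1 hdisj hNS
      rw [Finset.erase_eq_of_notMem hNT] at hTN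
      rw [himg T hNT, ← Finset.add_sum_erase S b hNS, hbN, hsum _ (Finset.notMem_erase N S)]
      exact hx1 T _ hTN hSN hcard
    · rw [Finset.erase_eq_of_notMem hNS] at hSN
      rw [hsum S hNS]
      by_cases hNT : N ∈ T
      · intro hmem
        have hc : (T.erase N).card + 1 = T.card := Finset.card_erase_add_one hNT
        have hT' : b '' T = insert (b N) (a '' (T.erase N)) := by
          rw [← himg _ (Finset.notMem_erase N T), ← Set.image_insert_eq, ← Finset.coe_insert,
            Finset.insert_erase hNT]
        rw [hT'] at hmem
        have hnot := ha (T.erase N) S hTN hSN (by omega) hne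
          (hdisj.mono_right (Finset.erase_subset _ _))
        -- Exchange: a sum in the span of the old columns and the new one, but not of the old ones
        -- alone, puts the new column in the span of the old ones and the sum.
        refine hx2 (T.erase N) S hTN hSN (by omega) ?_
        rw [← hbN]
        exact mem_span_insert_exchange hmem hnot
      · rw [Finset.erase_eq_of_notMem hNT] at hTN
        rw [himg T hNT]
        exact ha T S hTN hSN hcard hne hdisj

end Generic

/-! ## The scheme -/

section Scheme

variable {n m L B k : ℕ}

/-- Room to write the cached packets verbatim: `m * ⌊M B / m⌋` packets of `k` bits take at most `M B
k` bits. -/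
theorem card_placement_le {M : ℝ} (hM : 0 < M) (hm : 0 < m)
    (C : Placement n m M (uniformCaching m) B) (u : Fin n) (k : ℕ) :
    Fintype.card ({x : Packet m B // Cached C.1 u x} × Fin k) ≤ ⌊M * (B * k : ℕ)⌋₊ := by
  have h1 : Fintype.card {x : Packet m B // Cached C.1 u x} = ∑ f, (C.1 u f).card := by
    rw [Fintype.card_subtype, ← Finset.card_sigma]
    refine Finset.card_bij (fun x _ => ⟨x.1, x.2⟩) ?_ ?_ ?_
    · simp
    · rintro ⟨a, b⟩ _ ⟨a', b'⟩ _ h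
      simpa using h
    · rintro ⟨a, b⟩ h
      exact ⟨(a, b), by simpa using h, rfl⟩
  rw [Fintype.card_prod, h1, Fintype.card_fin]
  apply Nat.le_floor
  simp only [C.2 u, uniformCaching, Finset.sum_const, Finset.card_univ, Fintype.card_fin, smul_eq_mul]
  have h2 : ((⌊uniformCaching m (⟨0, hm⟩ : Fin m) * M * B⌋₊ : ℕ) : ℝ) ≤ 1 / m * M * B :=
    Nat.floor_le (by unfold uniformCaching; positivity)
  have hm' : (0 : ℝ) < m := by exact_mod_cast hm
  push_cast
  calc (m : ℝ) * (⌊1 / (m : ℝ) * M * B⌋₊ : ℝ) * k ≤ m * (1 / m * M * B) * k := by gcongr; exact h2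
    _ = M * (B * k) := by field_simp

/-- The codeword of greedy constrained local colouring determines the requested packets that
are not in the cache. -/
theorem codeword_determines {K : Type} [Field K] (o : ScanOrder n m L) (C : CacheConfig n m B)
    (d : Demand n m L) (a : ℕ → Fin (gclcLength o C d) → K)
    (ha : IsGeneric (gclcClasses o C d).length a) (D : Packet m B → K)
    (hD : ∑ y ∈ (vertices C d).image (fun v => (v.1, colourOf (gclcClasses o C d) v)),
      D y.1 • a y.2 = 0)
    {v : Vertex n m B} (hv : v ∈ vertices C d) (hcache : ∀ x, Cached C v.2 x → D x = 0) :
    D v.1 = 0 := by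
  classical
  by_contra hne
  obtain ⟨hlt, hprop⟩ := gclcClasses_spec o C d
  set c := colourOf (gclcClasses o C d) with hc
  set Y := (vertices C d).image fun v => (v.1, c v) with hY
  set Q := (closedOutNbhd C d v).image c with hQ
  have hvQ : c v ∈ Q := Finset.mem_image_of_mem _ (by simp [closedOutNbhd, hv])
  have hQcard : Q.card ≤ gclcLength o C d := by
    unfold gclcLength localColours
    exact Finset.le_sup (f := fun v => ((closedOutNbhd C d v).image c).card) hv
  set T := Q.erase (c v) with hT
  set S := ((Y.filter fun y => y.1 = v.1).image Prod.snd) \ T with hS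
  have hYlt : ∀ y ∈ Y, y.2 ∈ Finset.range (gclcClasses o C d).length := by
    intro y hy
    obtain ⟨w, hw, rfl⟩ := Finset.mem_image.1 hy
    exact Finset.mem_range.2 (hlt w hw)
  have hvS : c v ∈ S := by
    rw [hS, Finset.mem_sdiff, Finset.mem_image]
    exact ⟨⟨(v.1, c v), by simpa [hY] using ⟨v.1.1, v.1.2, v.2, hv, rfl, rfl⟩, rfl⟩,
      Finset.notMem_erase _ _⟩
  refine ha T S ?_ ?_ ?_ ⟨_, hvS⟩ Finset.sdiff_disjoint ?_
  · intro j hj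
    obtain ⟨w, hw, rfl⟩ := Finset.mem_image.1 (Finset.mem_of_mem_erase hj)
    exact Finset.mem_range.2 (hlt w (Finset.mem_filter.1 hw).1)
  · intro j hj
    obtain ⟨y, hy, rfl⟩ := Finset.mem_image.1 (Finset.mem_sdiff.1 hj).1
    exact hYlt y (Finset.mem_filter.1 hy).1
  · have := Finset.card_erase_add_one hvQ
    rw [← hT] at this
    omega
  · set U := Submodule.span K (a '' T) with hU
    have hTU : ∀ j ∈ T, a j ∈ U := fun j hj => Submodule.subset_span ⟨j, hj, rfl⟩
    rw [← Finset.sum_filter_add_sum_filter_not Y (fun y => y.1 = v.1)] at hD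
    have hrest : ∑ y ∈ Y.filter (fun y => ¬ y.1 = v.1), D y.1 • a y.2 ∈ U := by
      refine Submodule.sum_mem _ fun y hy => ?_
      obtain ⟨hyY, hyne⟩ := Finset.mem_filter.1 hy
      obtain ⟨w, hw, rfl⟩ := Finset.mem_image.1 hyY
      by_cases hca : Cached C v.2 w.1
      · simp [hcache _ hca]
      · have hedge : Edge C v w := ⟨hca, hyne⟩
        refine Submodule.smul_mem _ _ (hTU _ ?_)
        -- Properness enters here: an out-neighbour of `v` does not have the colour of `v`.
        refine Finset.mem_erase.2 ⟨fun h => hprop v hv w hw h.symm hedge, ?_⟩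
        exact Finset.mem_image_of_mem _ (Finset.mem_filter.2 ⟨hw, Or.inr hedge⟩)
    have hsame : ∑ y ∈ Y.filter (fun y => y.1 = v.1), D y.1 • a y.2 =
        D v.1 • ∑ j ∈ (Y.filter fun y => y.1 = v.1).image Prod.snd, a j := by
      rw [Finset.sum_image, Finset.smul_sum]
      · exact Finset.sum_congr rfl fun y hy => by rw [(Finset.mem_filter.1 hy).2]
      · intro y hy z hz h
        exact Prod.ext (((Finset.mem_filter.1 hy).2).trans (Finset.mem_filter.1 hz).2.symm) h
    have h1 : D v.1 • ∑ j ∈ (Y.filter fun y => y.1 = v.1).image Prod.snd, a j ∈ U := by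
      rw [← hsame, eq_neg_of_add_eq_zero_left hD]
      exact U.neg_mem hrest
    have h2 := (U.smul_mem_iff hne).1 h1
    rw [← Finset.sum_inter_add_sum_sdiff _ T] at h2
    exact (U.add_mem_iff_right (Submodule.sum_mem _ fun j hj =>
      hTU j (Finset.mem_of_mem_inter_right hj))).1 h2

theorem length_toBits {k ν : ℕ} (e : (Fin k → ZMod 2) ≃ₗ[ZMod 2] GaloisField 2 k)
    (x : Fin ν → GaloisField 2 k) : (toBits e x).length = ν * k := by
  simp [toBits, List.length_flatten, List.map_ofFn, Function.comp_def]

theorem ofFn_flatten_injective {X : Type} {k ν : ℕ} {f g : Fin ν → Fin k → X}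
    (h : (List.ofFn fun i => List.ofFn (f i)).flatten = (List.ofFn fun i => List.ofFn (g i)).flatten) :
    f = g := by
  induction ν with
  | zero => exact Subsingleton.elim _ _
  | succ ν ih =>
    simp only [List.ofFn_succ, List.flatten_cons] at h
    obtain ⟨h1, h2⟩ := List.append_inj h (by simp)
    have h3 := ih h2
    have h4 := List.ofFn_injective h1
    ext i j
    refine Fin.cases ?_ (fun i => ?_) i
    · rw [h4]
    · exact congrFun (congrFun h3 i) j

theorem toBits_injective {k ν : ℕ} (e : (Fin k → ZMod 2) ≃ₗ[ZMod 2] GaloisField 2 k) :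
    Function.Injective (toBits (ν := ν) e) := by
  intro x y h
  have := ofFn_flatten_injective h
  ext i
  exact e.symm.injective (congrFun this i)

theorem packetBits_ext {W W' : Library m (B * k)} {f : Fin m}
    (h : ∀ b, packetBits W (f, b) = packetBits W' (f, b)) : W f = W' f := by
  ext i
  obtain ⟨⟨b, j⟩, rfl⟩ := finProdFinEquiv.surjective i
  exact congrFun (h b) j

/-- The request matrices are finitely many and their colourings do not depend on `k`, while the
field has `2 ^ k` elements. -/
theorem eventually_isGeneric (o : ScanOrder n m L) (C : CacheConfig n m B) :
    ∀ᶠ k : ℕ in atTop, ∀ d : Demand n m L,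
      ∃ a : ℕ → Fin (gclcLength o C d) → GaloisField 2 k,
        IsGeneric (gclcClasses o C d).length a := by
  rw [eventually_all]
  intro d
  filter_upwards [eventually_gt_atTop (2 * 4 ^ (gclcClasses o C d).length * gclcLength o C d)]
    with k hk
  have : Fintype (GaloisField 2 k) := Fintype.ofFinite _
  refine exists_isGeneric _ (hk.trans ?_)
  rw [← Nat.card_eq_fintype_card, GaloisField.card 2 k (by omega)]
  exact Nat.lt_two_pow_self

/-- Greedy constrained local colouring gives an error-free caching scheme. -/
theorem exists_isGCLCScheme {M : ℝ} (hM : 0 < M) (hm : 0 < m) (hB : 0 < B) (q : Fin m → ℝ)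
    (o : ScanOrder n m L) (C : Placement n m M (uniformCaching m) B) :
    ∀ᶠ k : ℕ in atTop, ∃ S : CachingScheme n m L (B * k) ⌊M * (B * k : ℕ)⌋₊,
      IsGCLCScheme o C.1 S ∧ S.errorProb q = 0 ∧
      S.rate q = ENNReal.ofReal (gclcRate o C.1 q) := by
  classical
  filter_upwards [eventually_isGeneric o C.1, eventually_gt_atTop 0] with k hgen hk
  choose a ha using hgen
  have emb : ∀ u, Nonempty ({x : Packet m B // Cached C.1 u x} × Fin k ↪
      Fin ⌊M * (B * k : ℕ)⌋₊) := fun u =>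
    Function.Embedding.nonempty_of_card_le (by
      rw [Fintype.card_fin]; exact card_placement_le hM hm C u k)
  let E := fun u => (emb u).some
  obtain ⟨e⟩ : Nonempty ((Fin k → ZMod 2) ≃ₗ[ZMod 2] GaloisField 2 k) :=
    FiniteDimensional.nonempty_linearEquiv_of_finrank_eq (by
      rw [Module.finrank_fin_fun, GaloisField.finrank 2 hk.ne'])
  let cache : Fin n → Library m (B * k) → (Fin ⌊M * (B * k : ℕ)⌋₊ → ZMod 2) := fun u W =>
    Function.extend (E u) (fun y => packetBits W y.1.1 y.2) 0
  let encode : Library m (B * k) → Demand n m L → List (ZMod 2) := fun W d =>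
    toBits e fun i => ∑ y ∈ (vertices C.1 d).image
      (fun v => (v.1, colourOf (gclcClasses o C.1 d) v)), e (packetBits W y.1) * a d y.2 i
  have hcache : ∀ u W W', cache u W = cache u W' ↔
      ∀ x : Packet m B, Cached C.1 u x → packetBits W x = packetBits W' x := by
    intro u W W'
    constructor
    · intro h x hx
      ext i
      have := congrFun h (E u (⟨x, hx⟩, i))
      simpa only [cache, (E u).injective.extend_apply] using this
    · intro h
      have : (fun y : {x : Packet m B // Cached C.1 u x} × Fin k => packetBits W y.1.1 y.2) =
          fun y => packetBits W' y.1.1 y.2 := by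
        ext y
        rw [h y.1.1 y.1.2]
      simp only [cache, this]
  have hdec : ∀ u d W W', encode W d = encode W' d → cache u W = cache u W' →
      ∀ l, W (d u l) = W' (d u l) := by
    intro u d W W' h1 h2 l
    rw [hcache] at h2
    refine packetBits_ext fun b => ?_
    by_cases hc : Cached C.1 u (d u l, b)
    · exact h2 _ hc
    · have h3 := toBits_injective e h1
      have h4 := codeword_determines o C.1 d (a d) (ha d)
        (fun x => e (packetBits W x) - e (packetBits W' x)) (by
          ext i
          have := congrFun h3 i
          simp only [Finset.sum_apply, Pi.smul_apply, smul_eq_mul, sub_mul,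
            Finset.sum_sub_distrib, Pi.zero_apply]
          exact sub_eq_zero.2 this)
        (v := ((d u l, b), u)) ((mem_vertices C.1 d).2 ⟨⟨l, rfl⟩, hc⟩)
        (fun x hx => by rw [h2 x hx, sub_self])
      exact e.injective (sub_eq_zero.1 h4)
  -- The decoder picks any library consistent with what it sees; by `hdec` all of them agree on the
  -- requested files. The value `0` is never reached on genuine inputs.
  let decode : Fin n → List (ZMod 2) → (Fin ⌊M * (B * k : ℕ)⌋₊ → ZMod 2) → Demand n m L →
      (Fin L → Fin (B * k) → ZMod 2) := fun u X Z d =>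
    if h : ∃ W, encode W d = X ∧ cache u W = Z then fun l => h.choose (d u l) else 0
  refine ⟨⟨cache, encode, decode⟩, ⟨hcache, e, fun d => ⟨Matrix.of fun i j => a d j i,
    (ha d).isMDS, fun W => rfl⟩⟩, ?_, ?_⟩
  · unfold CachingScheme.errorProb
    refine (iSup_congr (g := fun _ => (0 : ℝ)) fun W => ?_).trans ciSup_const
    refine Finset.sum_eq_zero fun d _ => if_neg ?_
    push Not
    intro u
    have h : ∃ W', encode W' d = encode W d ∧ cache u W' = cache u W := ⟨W, rfl, rfl⟩
    simp only [decode, dif_pos h]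
    ext1 l
    exact hdec u d _ _ h.choose_spec.1 h.choose_spec.2 l
  · unfold CachingScheme.rate gclcRate
    have : ∀ W : Library m (B * k), ENNReal.ofReal ((∑ d : Demand n m L,
        demandProb q d * ((encode W d).length : ℝ)) / (B * k : ℕ)) =
        ENNReal.ofReal ((∑ d : Demand n m L, demandProb q d * (gclcLength o C.1 d : ℝ)) / B) := by
      intro W
      congr 1
      have hk' : (k : ℝ) ≠ 0 := by exact_mod_cast hk.ne'
      have hB' : (B : ℝ) ≠ 0 := by exact_mod_cast hB.ne'
      simp only [encode, length_toBits, Nat.cast_mul, ← mul_assoc, ← Finset.sum_mul]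
      field_simp
    simp only [this]
    exact ciSup_const

end Scheme

/-! ## Random subsets of a fixed size -/

section Subsets

variable {B : ℕ}

theorem card_powersetCard_disjoint (K : ℕ) (D : Finset (Fin B)) :
    ((Finset.powersetCard K (Finset.univ : Finset (Fin B))).filter fun A => Disjoint D A).card =
      (B - D.card).choose K := by
  have : ((Finset.powersetCard K (Finset.univ : Finset (Fin B))).filter fun A => Disjoint D A) =
      Finset.powersetCard K Dᶜ := by
    ext A
    simp only [Finset.mem_filter, Finset.mem_powersetCard, Finset.subset_univ, true_and]
    rw [and_comm, le_compl_iff_disjoint_left]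
  rw [this, Finset.card_powersetCard, Finset.card_compl, Fintype.card_fin]

theorem card_powersetCard_superset {K : ℕ} (hK : K ≤ B) (D : Finset (Fin B)) :
    ((Finset.powersetCard K (Finset.univ : Finset (Fin B))).filter fun A => D ⊆ A).card =
      (B - D.card).choose (B - K) := by
  rw [← card_powersetCard_disjoint]
  refine Finset.card_bij' (fun A _ => Aᶜ) (fun A _ => Aᶜ) ?_ ?_ ?_ ?_
  · intro A hA
    simp only [Finset.mem_filter, Finset.mem_powersetCard, Finset.subset_univ, true_and] at hA ⊢
    exact ⟨by rw [Finset.card_compl, Fintype.card_fin, hA.1],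
      (disjoint_compl_right (a := A)).mono_left hA.2⟩
  · intro A hA
    simp only [Finset.mem_filter, Finset.mem_powersetCard, Finset.subset_univ, true_and] at hA ⊢
    exact ⟨by rw [Finset.card_compl, Fintype.card_fin, hA.1]; omega,
      le_compl_iff_disjoint_right.2 hA.2⟩
  · simp
  · simp

theorem choose_pred_eq {K : ℕ} (hK : K ≤ B) (hB : 0 < B) :
    ((B - 1).choose K : ℝ) = B.choose K * (1 - K / B) := by
  obtain ⟨B, rfl⟩ : ∃ b, B = b + 1 := ⟨B - 1, by omega⟩
  have h := Nat.choose_mul_succ_eq B K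
  have h' : ((B.choose K : ℕ) : ℝ) * (B + 1) = (B + 1).choose K * (B + 1 - K) := by
    rw [← Nat.cast_add_one, ← Nat.cast_sub hK]
    exact_mod_cast h
  rw [Nat.add_sub_cancel]
  have : (B : ℝ) + 1 ≠ 0 := by positivity
  push_cast
  field_simp
  linarith

/-- Sampling without replacement: once one point is avoided, avoiding another has probability `1 - K
/ (B - 1) ≤ 1 - K / B`. The case `K = B` is separate because the second step needs `K ≤ B - 1`. -/
theorem choose_pred_pred_le {K : ℕ} (hK : K ≤ B) (hB : 2 ≤ B) :
    ((B - 2).choose K : ℝ) ≤ B.choose K * (1 - K / B) ^ 2 := by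
  rcases hK.eq_or_lt with rfl | hlt
  · rw [Nat.choose_eq_zero_of_lt (by omega), Nat.cast_zero]
    positivity
  · have h1 := choose_pred_eq hK (by omega)
    have h2 := choose_pred_eq (B := B - 1) (K := K) (by omega) (by omega)
    rw [show B - 1 - 1 = B - 2 by omega, h1] at h2
    rw [h2, sq, ← mul_assoc]
    have hB' : (2 : ℝ) ≤ B := by exact_mod_cast hB
    have hK' : (K : ℝ) ≤ B := by exact_mod_cast hK
    have h3 : (K : ℝ) / B ≤ K / (B - 1 : ℕ) := by
      rw [Nat.cast_sub (by omega)]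
      push_cast
      gcongr <;> linarith
    have h4 : (K : ℝ) / B ≤ 1 := div_le_one_of_le₀ hK' (by positivity)
    have : (0 : ℝ) ≤ B.choose K * (1 - K / B) := mul_nonneg (by positivity) (by linarith)
    gcongr

/-- The proposition `P` covers at once users inside and outside the prescribed set. -/
theorem card_mem_iff {K : ℕ} (hK : K ≤ B) (b : Fin B) (P : Prop) [Decidable P] :
    (((Finset.powersetCard K (Finset.univ : Finset (Fin B))).filter
      fun A => (b ∈ A ↔ P)).card : ℝ) =
      B.choose K * (if P then (K / B : ℝ) else 1 - K / B) := by
  have hB : 0 < B := b.pos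
  have hB' : (B : ℝ) ≠ 0 := by positivity
  by_cases hP : P
  · simp only [hP, iff_true, if_true]
    have h := card_powersetCard_superset hK {b}
    simp only [Finset.singleton_subset_iff, Finset.card_singleton] at h
    rw [h, choose_pred_eq (by omega) hB, Nat.choose_symm hK, Nat.cast_sub hK]
    field_simp
    ring
  · simp only [hP, iff_false, if_false]
    have h := card_powersetCard_disjoint K {b}
    simp only [Finset.disjoint_singleton_left, Finset.card_singleton] at h
    rw [h, choose_pred_eq hK hB]

/-- The events `b ∈ A` (or their complements) are negatively correlated for a random set `A` of
given size. -/
theorem card_mem_iff_mem_iff_le {K : ℕ} (hK : K ≤ B) {b b' : Fin B} (hb : b ≠ b') (P : Prop)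
    [Decidable P] :
    (((Finset.powersetCard K (Finset.univ : Finset (Fin B))).filter
      fun A => (b ∈ A ↔ P) ∧ (b' ∈ A ↔ P)).card : ℝ) ≤
      B.choose K * (if P then (K / B : ℝ) else 1 - K / B) ^ 2 := by
  have hB : 2 ≤ B := by
    have := b.isLt
    have := b'.isLt
    have : (b : ℕ) ≠ b' := fun h => hb (Fin.ext h)
    omega
  have hB' : (B : ℝ) ≠ 0 := by positivity
  by_cases hP : P
  · simp only [hP, iff_true, if_true]
    have h := card_powersetCard_superset hK {b, b'}
    simp only [Finset.insert_subset_iff, Finset.singleton_subset_iff, Finset.card_pair hb] at h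
    rw [h]
    refine (choose_pred_pred_le (by omega) hB).trans_eq ?_
    rw [Nat.choose_symm hK, Nat.cast_sub hK]
    field_simp
    ring
  · simp only [hP, iff_false, if_false]
    have h := card_powersetCard_disjoint K {b, b'}
    simp only [Finset.disjoint_insert_left, Finset.disjoint_singleton_left,
      Finset.card_pair hb] at h
    rw [h]
    exact choose_pred_pred_le hK hB

end Subsets

/-! ## Concentration of the number of packets with a given set of caching users -/

section Concentration

variable {n m B : ℕ}

/-- The packets of file `f` that are cached exactly by the users in `T`. -/
def exactSet (C : CacheConfig n m B) (f : Fin m) (T : Finset (Fin n)) : Finset (Fin B) :=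
  Finset.univ.filter fun b => ∀ u, b ∈ C u f ↔ u ∈ T

/-- The configurations in which every user caches `K` packets of every file. -/
def configs (n m B K : ℕ) : Finset (CacheConfig n m B) :=
  Fintype.piFinset fun _ => Fintype.piFinset fun _ => Finset.powersetCard K Finset.univ

theorem mem_configs {K : ℕ} {C : CacheConfig n m B} :
    C ∈ configs n m B K ↔ ∀ u f, (C u f).card = K := by
  simp [configs]

theorem card_configs (n m B K : ℕ) :
    ((configs n m B K).card : ℝ) = ∏ _u : Fin n, (B.choose K : ℝ) ^ m := by
  simp [configs, Fintype.card_piFinset]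

/-- Independence of the users; each of the other `m - 1` files contributes a free factor `B.choose
K`. -/
theorem sum_configs_prod (K : ℕ) (f : Fin m) (h : Fin n → Finset (Fin B) → ℝ) :
    ∑ C ∈ configs n m B K, ∏ u, h u (C u f) =
      ∏ u, ((B.choose K : ℝ) ^ (m - 1) * ∑ A ∈ Finset.powersetCard K Finset.univ, h u A) := by
  unfold configs
  rw [← Finset.prod_univ_sum (fun _ : Fin n => Fintype.piFinset fun _ : Fin m =>
    Finset.powersetCard K (Finset.univ : Finset (Fin B))) (fun u r => h u (r f))]
  refine Finset.prod_congr rfl fun u _ => ?_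
  rw [Fintype.sum_piFinset_apply]
  simp

/-- The probability that a packet is cached exactly by the users in `T`. -/
noncomputable def exactProb (n : ℕ) (a : ℝ) (t : ℕ) : ℝ := a ^ t * (1 - a) ^ (n - t)

theorem exactProb_eq_prod (a : ℝ) (T : Finset (Fin n)) :
    exactProb n a T.card = ∏ u : Fin n, if u ∈ T then a else 1 - a := by
  rw [Finset.prod_ite, Finset.prod_const, Finset.prod_const, exactProb]
  congr 2
  · simp
  · rw [Finset.filter_not, Finset.card_sdiff_of_subset (Finset.subset_univ _)]
    simp

theorem pow_pred_mul {x : ℝ} {m : ℕ} (hm : 0 < m) : x ^ (m - 1) * x = x ^ m := by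
  rw [← pow_succ, Nat.sub_add_cancel hm]

theorem card_filter_mem_exactSet {K : ℕ} (hK : K ≤ B) (f : Fin m) (T : Finset (Fin n))
    (b : Fin B) :
    ∑ C ∈ configs n m B K, (if b ∈ exactSet C f T then (1 : ℝ) else 0) =
      (configs n m B K).card * exactProb n (K / B) T.card := by
  classical
  have h1 : ∀ C : CacheConfig n m B, (if b ∈ exactSet C f T then (1 : ℝ) else 0) =
      ∏ u, if (b ∈ C u f ↔ u ∈ T) then (1 : ℝ) else 0 := by
    intro C
    rw [Finset.prod_ite_zero]
    simp [exactSet]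
  simp only [h1]
  rw [sum_configs_prod K f fun u A => if (b ∈ A ↔ u ∈ T) then (1 : ℝ) else 0, card_configs,
    exactProb_eq_prod, ← Finset.prod_mul_distrib]
  refine Finset.prod_congr rfl fun u _ => ?_
  rw [Finset.sum_boole, card_mem_iff hK, ← mul_assoc, pow_pred_mul f.pos]

/-- The users are independent and for each of them the two events are negatively correlated, so the
bound holds factor by factor. -/
theorem card_filter_mem_exactSet_pair_le {K : ℕ} (hK : K ≤ B) (f : Fin m) (T : Finset (Fin n))
    {b b' : Fin B} (hb : b ≠ b') :
    ∑ C ∈ configs n m B K, (if b ∈ exactSet C f T then (1 : ℝ) else 0) *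
        (if b' ∈ exactSet C f T then (1 : ℝ) else 0) ≤
      (configs n m B K).card * exactProb n (K / B) T.card ^ 2 := by
  classical
  have h1 : ∀ C : CacheConfig n m B, (if b ∈ exactSet C f T then (1 : ℝ) else 0) *
        (if b' ∈ exactSet C f T then (1 : ℝ) else 0) =
      ∏ u, if (b ∈ C u f ↔ u ∈ T) ∧ (b' ∈ C u f ↔ u ∈ T) then (1 : ℝ) else 0 := by
    intro C
    rw [Finset.prod_ite_zero, ite_zero_mul_ite_zero]
    simp [exactSet, forall_and]
  simp only [h1]
  rw [sum_configs_prod K f fun u A =>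
      if (b ∈ A ↔ u ∈ T) ∧ (b' ∈ A ↔ u ∈ T) then (1 : ℝ) else 0, card_configs,
    exactProb_eq_prod, ← Finset.prod_pow, ← Finset.prod_mul_distrib]
  refine Finset.prod_le_prod (fun u _ => ?_) fun u _ => ?_
  · rw [Finset.sum_boole]
    positivity
  · rw [Finset.sum_boole, ← pow_pred_mul f.pos, mul_assoc]
    gcongr
    exact card_mem_iff_mem_iff_le hK hb _

theorem exactProb_nonneg {a : ℝ} (h0 : 0 ≤ a) (h1 : a ≤ 1) (n t : ℕ) : 0 ≤ exactProb n a t :=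
  mul_nonneg (pow_nonneg h0 _) (pow_nonneg (by linarith) _)

theorem exactProb_le_one {a : ℝ} (h0 : 0 ≤ a) (h1 : a ≤ 1) (n t : ℕ) : exactProb n a t ≤ 1 :=
  mul_le_one₀ (pow_le_one₀ h0 h1) (pow_nonneg (by linarith) _)
    (pow_le_one₀ (by linarith) (by linarith))

/-- The variance is at most `B μ ≤ B`: diagonal pairs give `B μ`, and by negative correlation the
others do not exceed the square of the mean. -/
theorem sum_sq_card_exactSet_sub_le {K : ℕ} (hK : K ≤ B) (f : Fin m) (T : Finset (Fin n)) :
    ∑ C ∈ configs n m B K,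
        (((exactSet C f T).card : ℝ) - B * exactProb n (K / B) T.card) ^ 2 ≤
      (configs n m B K).card * B := by
  classical
  set μ := exactProb n (K / B) T.card with hμ
  set N : ℝ := ((configs n m B K).card : ℝ) with hN
  have ha1 : (K : ℝ) / B ≤ 1 := div_le_one_of_le₀ (by exact_mod_cast hK) (by positivity)
  have hμ0 : 0 ≤ μ := exactProb_nonneg (by positivity) ha1 _ _
  have hμ1 : μ ≤ 1 := exactProb_le_one (by positivity) ha1 _ _
  have hcard : ∀ C : CacheConfig n m B, ((exactSet C f T).card : ℝ) =
      ∑ b, if b ∈ exactSet C f T then (1 : ℝ) else 0 := by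
    intro C
    rw [Finset.sum_boole]
    simp
  have h1 : ∑ C ∈ configs n m B K, ((exactSet C f T).card : ℝ) = N * (B * μ) := by
    simp only [hcard]
    rw [Finset.sum_comm, Finset.sum_congr rfl fun b _ => card_filter_mem_exactSet hK f T b]
    simp
    ring
  have h2 : ∑ C ∈ configs n m B K, ((exactSet C f T).card : ℝ) ^ 2 ≤
      N * (B * μ + B ^ 2 * μ ^ 2) := by
    have e : ∀ C : CacheConfig n m B, ((exactSet C f T).card : ℝ) ^ 2 =
        ∑ b, ∑ b', (if b ∈ exactSet C f T then (1 : ℝ) else 0) *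
          (if b' ∈ exactSet C f T then (1 : ℝ) else 0) := by
      intro C
      rw [hcard, sq, Finset.sum_mul_sum]
    simp only [e]
    rw [Finset.sum_comm]
    have hb : ∀ b : Fin B, ∑ C ∈ configs n m B K, ∑ b',
        (if b ∈ exactSet C f T then (1 : ℝ) else 0) *
          (if b' ∈ exactSet C f T then (1 : ℝ) else 0) ≤ N * (μ + B * μ ^ 2) := by
      intro b
      rw [Finset.sum_comm, ← Finset.add_sum_erase _ _ (Finset.mem_univ b), mul_add]
      refine add_le_add (le_of_eq ?_) ?_
      · rw [hμ, hN, ← card_filter_mem_exactSet hK f T b]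
        refine Finset.sum_congr rfl fun C _ => ?_
        split_ifs <;> simp
      · refine (Finset.sum_le_card_nsmul _ _ (N * μ ^ 2) fun b' hb' =>
          card_filter_mem_exactSet_pair_le hK f T (Finset.ne_of_mem_erase hb').symm).trans ?_
        rw [nsmul_eq_mul]
        have : (((Finset.univ.erase b).card : ℕ) : ℝ) ≤ B := by
          have := Finset.card_erase_le (s := (Finset.univ : Finset (Fin B))) (a := b)
          rw [Finset.card_univ, Fintype.card_fin] at this
          exact_mod_cast this
        calc _ ≤ (B : ℝ) * (N * μ ^ 2) := by gcongr
          _ = _ := by ring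
    refine (Finset.sum_le_sum fun b _ => hb b).trans_eq ?_
    simp
    ring
  have h3 : ∑ C ∈ configs n m B K, (((exactSet C f T).card : ℝ) - B * μ) ^ 2 =
      ∑ C ∈ configs n m B K, ((exactSet C f T).card : ℝ) ^ 2 -
        2 * (B * μ) * ∑ C ∈ configs n m B K, ((exactSet C f T).card : ℝ) + N * (B * μ) ^ 2 := by
    rw [Finset.mul_sum, ← Finset.sum_sub_distrib, hN,
      ← nsmul_eq_mul (configs n m B K).card, ← Finset.sum_const, ← Finset.sum_add_distrib]
    exact Finset.sum_congr rfl fun C _ => by ring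
  rw [h3, h1]
  have h4 : N * (B * μ) ≤ N * B := by
    gcongr
    exact mul_le_of_le_one_right (by positivity) hμ1
  nlinarith

/-- Chebyshev's inequality for the number of packets of a file with a given set of users. -/
theorem card_exactSet_large_le {K : ℕ} (hK : K ≤ B) (hB : 0 < B) {δ : ℝ} (hδ : 0 < δ) :
    (((configs n m B K).filter fun C =>
      ∃ f T, B * (exactProb n (K / B) T.card + δ) < ((exactSet C f T).card : ℝ)).card : ℝ) ≤
      (configs n m B K).card * (m * 2 ^ n / (δ ^ 2 * B)) := by
  classical
  have hB' : (0 : ℝ) < B := by exact_mod_cast hB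
  have h1 : ∀ (f : Fin m) (T : Finset (Fin n)), (((configs n m B K).filter fun C =>
      B * (exactProb n (K / B) T.card + δ) < ((exactSet C f T).card : ℝ)).card : ℝ) ≤
      (configs n m B K).card / (δ ^ 2 * B) := by
    intro f T
    rw [le_div_iff₀ (by positivity)]
    have h2 : ((((configs n m B K).filter fun C =>
        B * (exactProb n (K / B) T.card + δ) < ((exactSet C f T).card : ℝ)).card : ℝ)) *
        (B * δ) ^ 2 ≤ (configs n m B K).card * B := by
      refine le_trans ?_ (sum_sq_card_exactSet_sub_le hK f T)
      rw [← nsmul_eq_mul, ← Finset.sum_const]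
      refine (Finset.sum_le_sum fun C hC => ?_).trans
        (Finset.sum_le_sum_of_subset_of_nonneg (Finset.filter_subset _ _)
          fun C _ _ => sq_nonneg _)
      have := (Finset.mem_filter.1 hC).2
      gcongr
      linarith
    have : (((configs n m B K).filter fun C =>
        B * (exactProb n (K / B) T.card + δ) < ((exactSet C f T).card : ℝ)).card : ℝ) *
        (δ ^ 2 * B) * B ≤ (configs n m B K).card * B := le_trans (le_of_eq (by ring)) h2
    exact le_of_mul_le_mul_right this hB'
  -- Union bound over the `m * 2 ^ n` pairs of a file and a set of users.
  have h2 : ((configs n m B K).filter fun C =>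
      ∃ f T, B * (exactProb n (K / B) T.card + δ) < ((exactSet C f T).card : ℝ)) ⊆
      (Finset.univ : Finset (Fin m × Finset (Fin n))).biUnion fun q =>
        (configs n m B K).filter fun C =>
          B * (exactProb n (K / B) q.2.card + δ) < ((exactSet C q.1 q.2).card : ℝ) := by
    intro C hC
    obtain ⟨hC, f, T, h⟩ := Finset.mem_filter.1 hC
    exact Finset.mem_biUnion.2 ⟨(f, T), Finset.mem_univ _, Finset.mem_filter.2 ⟨hC, h⟩⟩
  calc _ ≤ ((((Finset.univ : Finset (Fin m × Finset (Fin n))).biUnion fun q =>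
        (configs n m B K).filter fun C =>
          B * (exactProb n (K / B) q.2.card + δ) < ((exactSet C q.1 q.2).card : ℝ)).card : ℕ) : ℝ) := by
        exact_mod_cast Finset.card_le_card h2
    _ ≤ ∑ q : Fin m × Finset (Fin n), (((configs n m B K).filter fun C =>
          B * (exactProb n (K / B) q.2.card + δ) < ((exactSet C q.1 q.2).card : ℝ)).card : ℝ) := by
        exact_mod_cast Finset.card_biUnion_le
    _ ≤ ∑ q : Fin m × Finset (Fin n), ((configs n m B K).card : ℝ) / (δ ^ 2 * B) :=
        Finset.sum_le_sum fun q _ => h1 q.1 q.2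
    _ = _ := by
        simp
        ring

end Concentration

/-! ## Random requests -/

section Requests

variable {n m L : ℕ}

theorem sum_pi_prod {ι κ : Type} [Fintype ι] [DecidableEq ι] [Fintype κ] (h : ι → κ → ℝ) :
    ∑ x : ι → κ, ∏ i, h i (x i) = ∏ i, ∑ y, h i y := by
  rw [Finset.prod_univ_sum, Fintype.piFinset_univ]

theorem sum_demand_prod (g : Fin n → Fin L → Fin m → ℝ) :
    ∑ d : Demand n m L, ∏ u, ∏ l, g u l (d u l) = ∏ u, ∏ l, ∑ f, g u l f := by
  rw [sum_pi_prod (ι := Fin n) (κ := Fin L → Fin m) fun u x => ∏ l, g u l (x l)]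
  exact Finset.prod_congr rfl fun u _ => sum_pi_prod _

theorem sum_demandProb {q : Fin m → ℝ} (hq : ∑ f, q f = 1) :
    ∑ d : Demand n m L, demandProb q d = 1 := by
  unfold demandProb
  rw [sum_demand_prod fun _ _ => q]
  simp [hq]

theorem demandProb_nonneg {q : Fin m → ℝ} (hq : ∀ f, 0 ≤ q f) (d : Demand n m L) :
    0 ≤ demandProb q d :=
  Finset.prod_nonneg fun _ _ => Finset.prod_nonneg fun _ _ => hq _

theorem demandProb_pos {q : Fin m → ℝ} (hq : ∀ f, 0 < q f) (d : Demand n m L) :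
    0 < demandProb q d :=
  Finset.prod_pos fun _ _ => Finset.prod_pos fun _ _ => hq _

theorem zipf_sum_pos (α : ℝ) (hm : 0 < m) : 0 < ∑ i : Fin m, ((i : ℕ) + 1 : ℝ) ^ (-α) := by
  have : Nonempty (Fin m) := ⟨⟨0, hm⟩⟩
  exact Finset.sum_pos (fun i _ => by positivity) Finset.univ_nonempty

theorem zipf_pos (α : ℝ) (f : Fin m) : 0 < zipf α m f :=
  div_pos (by positivity) (zipf_sum_pos α f.pos)

theorem sum_zipf (α : ℝ) (hm : 0 < m) : ∑ f, zipf α m f = 1 := by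
  unfold zipf
  rw [← Finset.sum_div, div_self (zipf_sum_pos α hm).ne']

theorem gclcRate_le {B : ℕ} (o : ScanOrder n m L) (C : CacheConfig n m B) {q : Fin m → ℝ}
    (hq0 : ∀ f, 0 ≤ q f) (hq : ∑ f, q f = 1) (hB : 0 < B) {r : ℝ}
    (h : ∀ d, (gclcLength o C d : ℝ) ≤ B * r) : gclcRate o C q ≤ r := by
  unfold gclcRate
  have hB' : (0 : ℝ) < B := by exact_mod_cast hB
  rw [div_le_iff₀ hB']
  calc _ ≤ ∑ d : Demand n m L, demandProb q d * (B * r) :=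
        Finset.sum_le_sum fun d _ => mul_le_mul_of_nonneg_left (h d) (demandProb_nonneg hq0 d)
    _ = r * B := by rw [← Finset.sum_mul, sum_demandProb hq]; ring

end Requests

/-! ## Bounds on the number of local colours -/

section LocalColours

variable {n m L B : ℕ} (o : ScanOrder n m L) (C : CacheConfig n m B) (d : Demand n m L)

/-- The set of requested files. -/
def requested (d : Demand n m L) : Finset (Fin m) :=
  Finset.univ.image fun p : Fin n × Fin L => d p.1 p.2

/-- Colours correspond to packets here, and those near `v` belong to requested files and are not
cached by the user of `v`, who misses `B - K` packets of each file. -/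
theorem localColours_classes₂_le {K : ℕ} (hC : C ∈ configs n m B K) :
    localColours C d (colourOf (classes₂ o C d)) ≤ (requested d).card * (B - K) := by
  classical
  unfold localColours
  refine Finset.sup_le fun v hv => ?_
  obtain ⟨-, hiff⟩ := classes₂_spec o C d
  set c := colourOf (classes₂ o C d)
  let g : Packet m B → ℕ := fun x =>
    if h : ∃ w ∈ vertices C d, w.1 = x then c h.choose else 0
  have hg : ∀ w ∈ vertices C d, g w.1 = c w := by
    intro w hw
    have h : ∃ w' ∈ vertices C d, w'.1 = w.1 := ⟨w, hw, rfl⟩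
    simp only [g, dif_pos h]
    exact (hiff _ h.choose_spec.1 w hw).2 h.choose_spec.2
  have himg : (closedOutNbhd C d v).image c = ((closedOutNbhd C d v).image Prod.fst).image g := by
    rw [Finset.image_image]
    exact Finset.image_congr fun w hw => (hg w (Finset.mem_filter.1 hw).1).symm
  rw [himg]
  refine Finset.card_image_le.trans ?_
  have hsub : (closedOutNbhd C d v).image Prod.fst ⊆
      (requested d).biUnion fun f => (C v.2 f)ᶜ.image fun b => (f, b) := by
    intro x hx
    obtain ⟨w, hw, rfl⟩ := Finset.mem_image.1 hx
    obtain ⟨hw, hvw⟩ := Finset.mem_filter.1 hw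
    obtain ⟨⟨l, hl⟩, hcw⟩ := (mem_vertices C d).1 hw
    have hcv : ¬ Cached C v.2 w.1 := by
      rcases hvw with rfl | h
      · exact hcw
      · exact h.1
    refine Finset.mem_biUnion.2 ⟨w.1.1, ?_, Finset.mem_image.2 ⟨w.1.2, by simpa using hcv, rfl⟩⟩
    exact Finset.mem_image.2 ⟨(w.2, l), Finset.mem_univ _, hl⟩
  refine (Finset.card_le_card hsub).trans (Finset.card_biUnion_le_card_mul _ _ _ fun f _ => ?_)
  refine Finset.card_image_le.trans_eq ?_
  rw [Finset.card_compl, Fintype.card_fin, mem_configs.1 hC]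

/-- The user of a vertex does not cache its packet, so removing this user from the label leaves
exactly the caching users. -/
theorem mem_exactSet_of_userLabel {v : Vertex n m B} (hv : v ∈ vertices C d)
    {U : Finset (Fin n)} (hU : userLabel C v = U) : v.1.2 ∈ exactSet C v.1.1 (U.erase v.2) := by
  have hnc := ((mem_vertices C d).1 hv).2
  simp only [exactSet, Finset.mem_filter, Finset.mem_univ, true_and, ← hU, userLabel,
    Finset.mem_erase, Finset.mem_insert]
  intro u
  constructor
  · intro hu
    exact ⟨fun h => hnc (h ▸ hu), Or.inr hu⟩
  · rintro ⟨h1, h2 | h2⟩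
    · exact absurd h2 h1
    · exact h2

/-- Vertices of different users with the same label are compatible. -/
theorem compatible_of_userLabel_eq {v w : Vertex n m B} (h : userLabel C v = userLabel C w)
    (hne : v.2 ≠ w.2) : Compatible C v w := by
  refine ⟨fun he => he.1 ?_, fun he => he.1 ?_, h⟩
  · have : v.2 ∈ userLabel C w := h ▸ Finset.mem_insert_self _ _
    simpa [userLabel, hne] using this
  · have : w.2 ∈ userLabel C v := h ▸ Finset.mem_insert_self _ _
    simpa [userLabel, hne.symm] using this

/-- Let `v` have the largest colour among the vertices labelled `U`. Each smaller colour with this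
label contains a vertex incompatible with `v`. Equal labels and different users would make the two
compatible, so that vertex belongs to the user of `v`. Hence one user's vertices exhibit all these
colours. -/
theorem card_image_userLabel_le {X : ℕ → ℝ} (hX0 : ∀ t, 0 ≤ X t)
    (hX : ∀ f T, ((exactSet C f T).card : ℝ) ≤ X T.card) (U : Finset (Fin n)) :
    ((((vertices C d).filter fun v => userLabel C v = U).image
      (colourOf (classes₁ o C d))).card : ℝ) ≤ L * X (U.card - 1) := by
  classical
  obtain ⟨-, hprop, hmax⟩ := classes₁_spec o C d
  set c := colourOf (classes₁ o C d)
  set VU := (vertices C d).filter fun v => userLabel C v = U with hVU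
  rcases VU.eq_empty_or_nonempty with he | hne
  · rw [he, Finset.image_empty, Finset.card_empty, Nat.cast_zero]
    exact mul_nonneg (by positivity) (hX0 _)
  obtain ⟨v, hv, hvmax⟩ := VU.exists_max_image c hne
  obtain ⟨hvV, hvU⟩ := Finset.mem_filter.1 hv
  have hsub : VU.image c ⊆ (VU.filter fun w => w.2 = v.2).image c := by
    intro j hj
    obtain ⟨w, hw, rfl⟩ := Finset.mem_image.1 hj
    obtain ⟨hwV, hwU⟩ := Finset.mem_filter.1 hw
    rcases (hvmax w hw).eq_or_lt with heq | hlt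
    · exact Finset.mem_image.2 ⟨v, Finset.mem_filter.2 ⟨hv, rfl⟩, heq.symm⟩
    · obtain ⟨y, hyV, hyc, hy⟩ := hmax v hvV _ hlt
      have hyU : userLabel C y = U := ((hprop y hyV w hwV hyc).2.2).trans hwU
      refine Finset.mem_image.2
        ⟨y, Finset.mem_filter.2 ⟨Finset.mem_filter.2 ⟨hyV, hyU⟩, ?_⟩, hyc⟩
      by_contra hyv
      exact hy (compatible_of_userLabel_eq C (hyU.trans hvU.symm) hyv)
  have hsub2 : (VU.filter fun w => w.2 = v.2).image Prod.fst ⊆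
      (Finset.univ : Finset (Fin L)).biUnion fun l =>
        (exactSet C (d v.2 l) (U.erase v.2)).image fun b => (d v.2 l, b) := by
    intro x hx
    obtain ⟨w, hw, rfl⟩ := Finset.mem_image.1 hx
    obtain ⟨hw, hwv⟩ := Finset.mem_filter.1 hw
    obtain ⟨hwV, hwU⟩ := Finset.mem_filter.1 hw
    obtain ⟨⟨l, hl⟩, -⟩ := (mem_vertices C d).1 hwV
    have hex := mem_exactSet_of_userLabel C d hwV hwU
    rw [hwv] at hl hex
    refine Finset.mem_biUnion.2 ⟨l, Finset.mem_univ _, Finset.mem_image.2 ⟨w.1.2, ?_, ?_⟩⟩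
    · rwa [hl]
    · rw [hl]
  have hinj : Set.InjOn Prod.fst (VU.filter fun w => w.2 = v.2 : Set (Vertex n m B)) := by
    intro w hw w' hw' h
    exact Prod.ext h (((Finset.mem_filter.1 hw).2).trans (Finset.mem_filter.1 hw').2.symm)
  have hvU' : v.2 ∈ U := hvU ▸ Finset.mem_insert_self _ _
  calc ((VU.image c).card : ℝ) ≤ (((VU.filter fun w => w.2 = v.2).image c).card : ℝ) := by
        exact_mod_cast Finset.card_le_card hsub
    _ ≤ ((VU.filter fun w => w.2 = v.2).card : ℝ) := by exact_mod_cast Finset.card_image_le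
    _ = (((VU.filter fun w => w.2 = v.2).image Prod.fst).card : ℝ) := by
        rw [Finset.card_image_of_injOn hinj]
    _ ≤ (((Finset.univ : Finset (Fin L)).biUnion fun l =>
        (exactSet C (d v.2 l) (U.erase v.2)).image fun b => (d v.2 l, b)).card : ℝ) := by
        exact_mod_cast Finset.card_le_card hsub2
    _ ≤ ∑ l : Fin L, (((exactSet C (d v.2 l) (U.erase v.2)).image
        fun b => (d v.2 l, b)).card : ℝ) := by exact_mod_cast Finset.card_biUnion_le
    _ ≤ ∑ _l : Fin L, X (U.card - 1) := by
        refine Finset.sum_le_sum fun l _ => ?_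
        refine le_trans (by exact_mod_cast Finset.card_image_le) ((hX (d v.2 l) _).trans_eq ?_)
        rw [Finset.card_erase_of_mem hvU']
    _ = L * X (U.card - 1) := by simp

/-- The crude bound by the total number of colours suffices. A label contains the user of its
vertex, so only nonempty `U` contribute. -/
theorem localColours_classes₁_le {X : ℕ → ℝ} (hX0 : ∀ t, 0 ≤ X t)
    (hX : ∀ f T, ((exactSet C f T).card : ℝ) ≤ X T.card) :
    (localColours C d (colourOf (classes₁ o C d)) : ℝ) ≤
      ∑ U ∈ (Finset.univ : Finset (Finset (Fin n))).filter (·.Nonempty), L * X (U.card - 1) := by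
  classical
  set c := colourOf (classes₁ o C d)
  have h1 : localColours C d c ≤ ((vertices C d).image c).card :=
    Finset.sup_le fun v _ => Finset.card_le_card (Finset.image_subset_image
      (Finset.filter_subset _ _))
  have h2 : (vertices C d).image c ⊆
      ((Finset.univ : Finset (Finset (Fin n))).filter (·.Nonempty)).biUnion fun U =>
        ((vertices C d).filter fun v => userLabel C v = U).image c := by
    intro j hj
    obtain ⟨v, hv, rfl⟩ := Finset.mem_image.1 hj
    refine Finset.mem_biUnion.2 ⟨userLabel C v, ?_, ?_⟩
    · exact Finset.mem_filter.2 ⟨Finset.mem_univ _, ⟨v.2, Finset.mem_insert_self _ _⟩⟩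
    · exact Finset.mem_image_of_mem _ (Finset.mem_filter.2 ⟨hv, rfl⟩)
  refine le_trans (b := (((Finset.univ.filter Finset.Nonempty).biUnion fun U : Finset (Fin n) =>
    ((vertices C d).filter fun v => userLabel C v = U).image c).card : ℝ)) ?_ ?_
  · exact_mod_cast h1.trans (Finset.card_le_card h2)
  · refine le_trans (by exact_mod_cast Finset.card_biUnion_le)
      (Finset.sum_le_sum fun U _ => card_image_userLabel_le o C d hX0 hX U)

/-- Lowering the exponent of `a` by one and raising that of `1 - a` multiplies a term by `1 / a -
1`, and the unshifted terms form part of a binomial expansion with sum `1`. -/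
theorem sum_exactProb_pred_le {a : ℝ} (ha0 : 0 < a) (ha1 : a ≤ 1) (n : ℕ) :
    ∑ U ∈ (Finset.univ : Finset (Finset (Fin n))).filter (·.Nonempty),
      exactProb n a (U.card - 1) ≤ 1 / a - 1 := by
  have h1 : ∀ U ∈ (Finset.univ : Finset (Finset (Fin n))).filter (·.Nonempty),
      exactProb n a (U.card - 1) = (1 / a - 1) * exactProb n a U.card := by
    intro U hU
    have hpos := (Finset.mem_filter.1 hU).2.card_pos
    have hle : U.card ≤ n := by simpa using Finset.card_le_univ U
    obtain ⟨t, ht⟩ : ∃ t, U.card = t + 1 := ⟨U.card - 1, by omega⟩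
    obtain ⟨s, rfl⟩ : ∃ s, n = t + 1 + s := ⟨n - (t + 1), by omega⟩
    unfold exactProb
    rw [ht, Nat.add_sub_cancel, show t + 1 + s - t = s + 1 by omega, Nat.add_sub_cancel_left]
    field_simp
    ring
  rw [Finset.sum_congr rfl h1, ← Finset.mul_sum]
  have h2 : ∑ U ∈ (Finset.univ : Finset (Finset (Fin n))).filter (·.Nonempty),
      exactProb n a U.card ≤ 1 := by
    refine (Finset.sum_le_sum_of_subset_of_nonneg (Finset.filter_subset _ _)
      fun U _ _ => exactProb_nonneg ha0.le ha1 n _).trans_eq ?_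
    unfold exactProb
    rw [Fin.sum_pow_mul_eq_add_pow]
    simp
  refine mul_le_of_le_one_right ?_ h2
  rw [sub_nonneg, le_div_iff₀ ha0]
  linarith

end LocalColours

/-! ## The rate for a random placement -/

section Rate

variable {n m L B : ℕ}

theorem one_sub_le_placementProb {M : ℝ}
    (hK : ⌊1 / (m : ℝ) * M * B⌋₊ ≤ B) (E : Placement n m M (uniformCaching m) B → Prop)
    (bad : Finset (CacheConfig n m B)) (hbad : ∀ C, ¬ E C → C.1 ∈ bad) {x : ℝ}
    (hx : (bad.card : ℝ) ≤ (configs n m B ⌊1 / (m : ℝ) * M * B⌋₊).card * x) :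
    1 - x ≤ placementProb E ∧ placementProb E ≤ 1 := by
  classical
  set N := (configs n m B ⌊1 / (m : ℝ) * M * B⌋₊).card with hN
  have h1 : Nat.card (Placement n m M (uniformCaching m) B) = N :=
    Nat.subtype_card _ fun C => mem_configs
  have hN0 : (0 : ℝ) < N := by
    rw [hN, card_configs]
    have := Nat.choose_pos hK
    positivity
  have h2 : Nat.card {C // E C} = (Finset.univ.filter E).card :=
    Nat.subtype_card _ fun C => by simp
  have h3 : (Finset.univ.filter E).card + (Finset.univ.filter fun C => ¬ E C).card = N := by
    rw [Finset.card_filter_add_card_filter_not, Finset.card_univ, ← Nat.card_eq_fintype_card, h1]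
  have h4 : (Finset.univ.filter fun C => ¬ E C).card ≤ bad.card :=
    Finset.card_le_card_of_injOn Subtype.val
      (fun C hC => hbad C (Finset.mem_filter.1 hC).2) Subtype.val_injective.injOn
  have h3' : ((Finset.univ.filter E).card : ℝ) + (Finset.univ.filter fun C => ¬ E C).card = N := by
    exact_mod_cast h3
  have h4' : ((Finset.univ.filter fun C => ¬ E C).card : ℝ) ≤ bad.card := by exact_mod_cast h4
  have h5 : (0 : ℝ) ≤ (Finset.univ.filter fun C => ¬ E C).card := by positivity
  unfold placementProb
  rw [h1, h2, le_div_iff₀ hN0, div_le_one hN0]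
  constructor <;> nlinarith

theorem rateBound_nonneg {M : ℝ} (hM : 0 < M) (hMm : M ≤ m) : 0 ≤ rateBound n m L M := by
  have h1 : 0 ≤ (m : ℝ) / M - 1 := by
    rw [sub_nonneg, le_div_iff₀ hM]
    linarith
  exact le_min (by positivity) (le_min (by positivity) (by linarith))

theorem card_requested_le (d : Demand n m L) :
    (requested d).card ≤ m ∧ (requested d).card ≤ L * n := by
  constructor
  · simpa using Finset.card_le_univ (requested d)
  · refine Finset.card_image_le.trans_eq ?_
    simp [mul_comm]

/-- The first term of the minimum comes from the label colouring, the other two from the packet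
colouring. Rounding `K` down costs at most `m / B` in the last term; in the first, `hδ` absorbs it.
-/
theorem gclcLength_le_rateBound (o : ScanOrder n m L) {M δ : ℝ} (hM : 0 < M) (hMm : M ≤ m)
    (hB : 0 < B) {K : ℕ} (hK : K = ⌊1 / (m : ℝ) * M * B⌋₊) (hKB : K ≤ B) (hK0 : 0 < K)
    (hmB : (m : ℝ) / B ≤ δ) {η : ℝ} (hη : 0 ≤ η)
    (hδ : L * (1 / (K / B : ℝ) - 1 + 2 ^ n * η) ≤ L * (m / M - 1) + δ) {C : CacheConfig n m B}
    (hC : C ∈ configs n m B K)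
    (hgood : ∀ f T, ((exactSet C f T).card : ℝ) ≤ B * (exactProb n (K / B) T.card + η))
    (d : Demand n m L) :
    (gclcLength o C d : ℝ) ≤ B * (rateBound n m L M + δ) := by
  have hB' : (0 : ℝ) < B := by exact_mod_cast hB
  have hK0' : (0 : ℝ) < K := by exact_mod_cast hK0
  have hm0 : (0 : ℝ) < m := hM.trans_le hMm
  have hKB' : (K : ℝ) ≤ B := by exact_mod_cast hKB
  have hδ0 : 0 ≤ δ := le_trans (by positivity) hmB
  have ha1 : (K : ℝ) / B ≤ 1 := div_le_one_of_le₀ hKB' hB'.le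
  have h1 : (gclcLength o C d : ℝ) ≤ B * (L * (m / M - 1) + δ) := by
    refine le_trans (by exact_mod_cast gclcLength_le_left o C d) ((localColours_classes₁_le o C d
      (X := fun t => B * (exactProb n (K / B) t + η)) (fun t => ?_) hgood).trans ?_)
    · have := exactProb_nonneg (a := K / B) (by positivity) ha1 n t
      positivity
    · have h2 := sum_exactProb_pred_le (a := K / B) (by positivity) ha1 n
      have h3 : ∑ U ∈ (Finset.univ : Finset (Finset (Fin n))).filter (·.Nonempty), η ≤
          2 ^ n * η := by
        rw [Finset.sum_const, nsmul_eq_mul]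
        gcongr
        have := Finset.card_filter_le (Finset.univ : Finset (Finset (Fin n))) (·.Nonempty)
        rw [Finset.card_univ, Fintype.card_finset, Fintype.card_fin] at this
        exact_mod_cast this
      rw [← Finset.mul_sum, ← Finset.mul_sum, Finset.sum_add_distrib]
      calc _ ≤ (L : ℝ) * (B * (1 / (K / B : ℝ) - 1 + 2 ^ n * η)) := by gcongr
        _ = B * (L * (1 / (K / B : ℝ) - 1 + 2 ^ n * η)) := by ring
        _ ≤ _ := by gcongr
  have h2 : (gclcLength o C d : ℝ) ≤ (requested d).card * (B - K) := by
    rw [← Nat.cast_sub hKB]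
    exact_mod_cast (gclcLength_le_right o C d).trans (localColours_classes₂_le o C d hC)
  obtain ⟨h3, h4⟩ := card_requested_le d
  have h3' : ((requested d).card : ℝ) ≤ m := by exact_mod_cast h3
  have h4' : ((requested d).card : ℝ) ≤ L * n := by exact_mod_cast h4
  have h5 : (gclcLength o C d : ℝ) ≤ B * (L * n + δ) := by
    calc _ ≤ ((requested d).card : ℝ) * (B - K) := h2
      _ ≤ (L * n : ℝ) * B := by
        gcongr
        linarith
      _ ≤ B * (L * n + δ) := by nlinarith
  have h6 : (gclcLength o C d : ℝ) ≤ B * (m - M + δ) := by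
    have hfl : 1 / (m : ℝ) * M * B < K + 1 := by
      rw [hK]
      exact Nat.lt_floor_add_one _
    calc _ ≤ ((requested d).card : ℝ) * (B - K) := h2
      _ ≤ m * (B - K) := by gcongr
      _ ≤ m * (B - (1 / (m : ℝ) * M * B - 1)) := by
        gcongr
        linarith
      _ = B * (m - M + m / B) := by
        field_simp
        ring
      _ ≤ _ := by gcongr
  unfold rateBound
  rw [← min_add_add_right, ← min_add_add_right, mul_min_of_nonneg _ _ hB'.le,
    mul_min_of_nonneg _ _ hB'.le]
  exact le_min h1 (le_min h5 h6)

/-- The upper bound on the rate of uniform placement with greedy constrained local colouring. -/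
theorem rateAtMost_rateBound {M : ℝ} (hM : 0 < M) (hMm : M ≤ m) (hL : 1 ≤ L) {q : Fin m → ℝ}
    (hq0 : ∀ f, 0 ≤ q f) (hq : ∑ f, q f = 1) (o : ScanOrder n m L) :
    RateAtMost o M q (uniformCaching m) (ENNReal.ofReal (rateBound n m L M)) := by
  intro δ hδ
  have hm0 : (0 : ℝ) < m := hM.trans_le hMm
  have hL0 : (0 : ℝ) < L := by exact_mod_cast hL
  set p : ℝ := 1 / (m : ℝ) * M with hp
  have hp0 : 0 < p := by positivity
  have hp1 : p ≤ 1 := by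
    rw [hp, one_div, inv_mul_le_iff₀ hm0]
    linarith
  -- Half of `δ` pays for the deviations over at most `2 ^ n` labels, the other half for replacing
  -- `M / m` by `K / B`.
  set η : ℝ := δ / (2 * L * 2 ^ n) with hη
  have hη0 : 0 < η := by positivity
  have hKB : ∀ B : ℕ, ⌊p * B⌋₊ ≤ B := by
    intro B
    refine Nat.floor_le_of_le ?_
    exact mul_le_of_le_one_left (by positivity) hp1
  have hlim : Tendsto (fun B : ℕ => ((⌊p * B⌋₊ : ℕ) : ℝ) / B) atTop (𝓝 p) :=
    (tendsto_nat_floor_mul_div_atTop hp0.le).comp tendsto_natCast_atTop_atTop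
  have hev1 : ∀ᶠ B : ℕ in atTop, 1 / (((⌊p * B⌋₊ : ℕ) : ℝ) / B) < 1 / p + δ / (2 * L) := by
    have : Tendsto (fun B : ℕ => 1 / (((⌊p * B⌋₊ : ℕ) : ℝ) / B)) atTop (𝓝 (1 / p)) :=
      tendsto_const_nhds.div hlim hp0.ne'
    exact this.eventually_lt_const (lt_add_of_pos_right _ (by positivity))
  have hev2 : ∀ᶠ B : ℕ in atTop, (0 : ℝ) < ((⌊p * B⌋₊ : ℕ) : ℝ) / B :=
    hlim.eventually_const_lt hp0
  have hev3 : ∀ᶠ B : ℕ in atTop, (m : ℝ) / B ≤ δ :=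
    ((tendsto_const_div_atTop_nhds_zero_nat (m : ℝ)).eventually_lt_const hδ).mono
      fun B h => h.le
  have hmain : ∀ᶠ B : ℕ in atTop, 1 - m * 2 ^ n / (η ^ 2 * B) ≤
      placementProb (fun C : Placement n m M (uniformCaching m) B =>
        ENNReal.ofReal (gclcRate o C.1 q) ≤
          ENNReal.ofReal (rateBound n m L M) + ENNReal.ofReal δ) ∧
      placementProb (fun C : Placement n m M (uniformCaching m) B =>
        ENNReal.ofReal (gclcRate o C.1 q) ≤
          ENNReal.ofReal (rateBound n m L M) + ENNReal.ofReal δ) ≤ 1 := by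
    filter_upwards [hev1, hev2, hev3, eventually_gt_atTop 0] with B h1 h2 h3 hB
    have hB' : (0 : ℝ) < B := by exact_mod_cast hB
    refine one_sub_le_placementProb (hKB B) _ _ (fun C hC => ?_)
      (card_exactSet_large_le (hKB B) hB hη0)
    have hCmem : C.1 ∈ configs n m B ⌊p * B⌋₊ := mem_configs.2 C.2
    refine Finset.mem_filter.2 ⟨hCmem, ?_⟩
    by_contra! hgood
    refine hC ?_
    rw [← ENNReal.ofReal_add (rateBound_nonneg hM hMm) hδ.le]
    refine ENNReal.ofReal_le_ofReal (gclcRate_le o C.1 hq0 hq hB fun d => ?_)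
    refine gclcLength_le_rateBound o hM hMm hB rfl (hKB B) ?_ h3 hη0.le ?_ hCmem hgood d
    · have : (0 : ℝ) < (⌊p * B⌋₊ : ℕ) := by
        by_contra hcon
        have : ((⌊p * B⌋₊ : ℕ) : ℝ) / B ≤ 0 := div_nonpos_of_nonpos_of_nonneg (not_lt.1 hcon) hB'.le
        linarith
      exact_mod_cast this
    · have e1 : 1 / p = m / M := by
        rw [hp]
        field_simp
      have e2 : (2 : ℝ) ^ n * η = δ / (2 * L) := by
        rw [hη]
        field_simp
      rw [e1] at h1
      rw [e2]
      calc _ ≤ (L : ℝ) * (m / M + δ / (2 * L) - 1 + δ / (2 * L)) := by gcongr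
        _ = _ := by
          field_simp
          ring
  have hlow : Tendsto (fun B : ℕ => 1 - (m : ℝ) * 2 ^ n / (η ^ 2 * B)) atTop (𝓝 1) := by
    have : Tendsto (fun B : ℕ => (m : ℝ) * 2 ^ n / η ^ 2 / B) atTop (𝓝 0) :=
      tendsto_const_div_atTop_nhds_zero_nat _
    simpa [div_div] using this.const_sub 1
  exact tendsto_of_tendsto_of_tendsto_of_le_of_le' hlow tendsto_const_nhds
    (hmain.mono fun _ h => h.1) (hmain.mono fun _ h => h.2)

end Rate

/-! ## The cut-set bound -/

section Counting

theorem card_filter_length_le (A : Finset (List (ZMod 2))) (k : ℕ) :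
    (A.filter fun x => x.length = k).card ≤ 2 ^ k := by
  have h : Fintype.card (List.Vector (ZMod 2) k) = 2 ^ k := by
    rw [card_vector, ZMod.card]
  rw [← h, ← Finset.card_univ]
  refine Finset.card_le_card_of_surjOn (fun v : List.Vector (ZMod 2) k => v.1) ?_
  intro x hx
  exact ⟨⟨x, (Finset.mem_filter.1 hx).2⟩, Finset.mem_coe.2 (Finset.mem_univ _), rfl⟩

/-- The codewords need not be prefix-free, so Kraft's inequality is not available. Weight `4 ^ (-k)`
on at most `2 ^ k` strings of length `k` is summable, at the price of a factor `2` in the lengths.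
-/
theorem sum_quarter_pow_length_le (A : Finset (List (ZMod 2))) :
    ∑ x ∈ A, (1 / 4 : ℝ) ^ x.length ≤ 2 := by
  classical
  have h1 : ∀ x ∈ A, x.length ∈ A.image List.length := fun x hx => Finset.mem_image_of_mem _ hx
  rw [← Finset.sum_fiberwise_of_maps_to h1]
  have h2 : ∀ k ∈ A.image List.length,
      ∑ x ∈ A.filter (fun x => x.length = k), (1 / 4 : ℝ) ^ x.length ≤ (1 / 2 : ℝ) ^ k := by
    intro k _
    rw [Finset.sum_congr rfl fun x hx => by rw [(Finset.mem_filter.1 hx).2], Finset.sum_const,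
      nsmul_eq_mul]
    have : ((A.filter fun x => x.length = k).card : ℝ) ≤ 2 ^ k := by
      exact_mod_cast card_filter_length_le A k
    calc _ ≤ (2 : ℝ) ^ k * (1 / 4) ^ k := by gcongr
      _ = (1 / 2) ^ k := by rw [← mul_pow]; norm_num
  refine (Finset.sum_le_sum h2).trans ?_
  have h3 := summable_geometric_two.sum_le_tsum (A.image List.length) fun k _ => by positivity
  rwa [tsum_geometric_two] at h3

variable {n m L F cap t : ℕ}

/-- The files requested by the users in `U` in a sequence of request matrices. -/
def requestedFiles (U : Finset (Fin n)) (D : Fin t → Demand n m L) : Finset (Fin m) :=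
  Finset.univ.filter fun f => ∃ i, ∃ u ∈ U, ∃ l, D i u l = f

/-- A scheme without errors. -/
def CachingScheme.IsErrorFree (S : CachingScheme n m L F cap) : Prop :=
  ∀ W d u, S.decode u (S.encode W d) (S.cache u W) d = fun l => W (d u l)

/-- A library is determined by the `t` codewords, the caches of `U` and the files that `U` does not
request; the weighted sum over such triples factorises. -/
theorem CachingScheme.IsErrorFree.sum_quarter_pow_le {S : CachingScheme n m L F cap}
    (hS : S.IsErrorFree) (U : Finset (Fin n)) (D : Fin t → Demand n m L) :
    ∑ W, ∏ i, (1 / 4 : ℝ) ^ (S.encode W (D i)).length ≤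
      2 ^ t * (2 ^ (cap * U.card) * 2 ^ (F * (m - (requestedFiles U D).card))) := by
  classical
  set R := requestedFiles U D with hR
  let Z := U → Fin cap → ZMod 2
  let Y := {f // f ∉ R} → Fin F → ZMod 2
  let Φ : Library m F → (Fin t → List (ZMod 2)) × (Z × Y) := fun W =>
    (fun i => S.encode W (D i), fun u => S.cache u W, fun f => W f)
  have hΦ : Function.Injective Φ := by
    intro W W' h
    simp only [Φ, Prod.mk.injEq] at h
    obtain ⟨h1, h2, h3⟩ := h
    ext1 f
    by_cases hf : f ∈ R
    · obtain ⟨i, u, hu, l, rfl⟩ := (Finset.mem_filter.1 hf).2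
      have e1 := congrFun (hS W (D i) u) l
      have e2 := congrFun (hS W' (D i) u) l
      rw [← e1, ← e2]
      have e3 := congrFun h1 i
      have e4 := congrFun h2 ⟨u, hu⟩
      simp only at e3 e4
      rw [e3, e4]
    · exact congrFun h3 ⟨f, hf⟩
  let A : Fin t → Finset (List (ZMod 2)) := fun i => Finset.univ.image fun W => S.encode W (D i)
  let w : (Fin t → List (ZMod 2)) × (Z × Y) → ℝ := fun x => ∏ i, (1 / 4 : ℝ) ^ (x.1 i).length
  have h1 : ∑ W, ∏ i, (1 / 4 : ℝ) ^ (S.encode W (D i)).length =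
      ∑ x ∈ Finset.univ.image Φ, w x := by
    rw [Finset.sum_image hΦ.injOn]
  have h2 : Finset.univ.image Φ ⊆
      (Fintype.piFinset A) ×ˢ (Finset.univ : Finset (Z × Y)) := by
    intro x hx
    obtain ⟨W, -, rfl⟩ := Finset.mem_image.1 hx
    simp [Φ, A]
  have hZ : Fintype.card (Z × Y) = 2 ^ (cap * U.card) * 2 ^ (F * (m - R.card)) := by
    have e : Fintype.card {f // f ∉ R} = m - R.card := by simp
    rw [Fintype.card_prod]
    simp only [Z, Y, Fintype.card_fun, ZMod.card, Fintype.card_fin, Fintype.card_coe, ← pow_mul, e]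
  rw [h1]
  calc _ ≤ ∑ x ∈ (Fintype.piFinset A) ×ˢ (Finset.univ : Finset (Z × Y)), w x :=
        Finset.sum_le_sum_of_subset_of_nonneg h2 fun x _ _ =>
          Finset.prod_nonneg fun i _ => by positivity
    _ = (∑ x ∈ Fintype.piFinset A, ∏ i, (1 / 4 : ℝ) ^ (x i).length) *
          (2 ^ (cap * U.card) * 2 ^ (F * (m - R.card))) := by
        rw [Finset.sum_product, Finset.sum_mul]
        refine Finset.sum_congr rfl fun x _ => ?_
        simp only [w]
        rw [Finset.sum_const, Finset.card_univ, hZ, nsmul_eq_mul, mul_comm]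
        push_cast
        rfl
    _ ≤ 2 ^ t * (2 ^ (cap * U.card) * 2 ^ (F * (m - R.card))) := by
        gcongr
        rw [← Finset.prod_univ_sum A fun _ x => (1 / 4 : ℝ) ^ x.length]
        calc _ ≤ ∏ _i : Fin t, (2 : ℝ) :=
              Finset.prod_le_prod (fun i _ => Finset.sum_nonneg fun _ _ => by positivity)
                fun i _ => sum_quarter_pow_length_le _
          _ = 2 ^ t := by simp

theorem CachingScheme.IsErrorFree.sum_length_ge {S : CachingScheme n m L F cap}
    (hS : S.IsErrorFree) (U : Finset (Fin n)) (D : Fin t → Demand n m L) :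
    ∑ _W : Library m F, ((F : ℝ) * (requestedFiles U D).card - U.card * cap - t) ≤
      ∑ W, 2 * ∑ i, ((S.encode W (D i)).length : ℝ) := by
  set R := requestedFiles U D with hR
  set κ : ℝ := (F : ℝ) * R.card - U.card * cap - t with hκ
  have hlog : 0 < Real.log 2 := Real.log_pos (by norm_num)
  have hRm : R.card ≤ m := by simpa using Finset.card_le_univ R
  have hpow : ∀ k : ℕ, (2 : ℝ) ^ k = Real.exp (Real.log 2 * k) := by
    intro k
    rw [mul_comm, Real.exp_nat_mul, Real.exp_log (by norm_num)]
  have h1 : ∑ W : Library m F,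
      Real.exp (Real.log 2 * (κ - 2 * ∑ i, ((S.encode W (D i)).length : ℝ))) ≤
      ∑ _W : Library m F, 1 := by
    have e1 : ∀ W : Library m F,
        Real.exp (Real.log 2 * (κ - 2 * ∑ i, ((S.encode W (D i)).length : ℝ))) =
        Real.exp (Real.log 2 * κ) * ∏ i, (1 / 4 : ℝ) ^ (S.encode W (D i)).length := by
      intro W
      have e2 : ∀ k : ℕ, (1 / 4 : ℝ) ^ k = Real.exp (-2 * Real.log 2 * k) := by
        intro k
        rw [mul_comm, Real.exp_nat_mul, show -2 * Real.log 2 = -(Real.log 2 + Real.log 2) by ring,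
          Real.exp_neg, Real.exp_add, Real.exp_log (by norm_num)]
        norm_num
      simp only [e2]
      rw [← Real.exp_sum, ← Real.exp_add, ← Finset.mul_sum]
      ring_nf
    simp only [e1]
    rw [← Finset.mul_sum]
    refine (mul_le_mul_of_nonneg_left (hS.sum_quarter_pow_le U D) (Real.exp_nonneg _)).trans_eq ?_
    rw [Finset.sum_const, Finset.card_univ, nsmul_eq_mul, mul_one]
    have e3 : Fintype.card (Library m F) = 2 ^ (F * m) := by
      simp [Library, ← pow_mul]
    rw [e3, Nat.cast_pow, Nat.cast_ofNat]
    simp only [hpow]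
    rw [← Real.exp_add, ← Real.exp_add, ← Real.exp_add]
    congr 1
    rw [← hR, hκ]
    push_cast [Nat.cast_sub hRm]
    ring
  rw [← sub_nonneg, ← Finset.sum_sub_distrib]
  -- Passing from exponentials to lengths: `1 + x ≤ exp x` plays the role of Jensen's inequality.
  have h2 : ∑ W : Library m F, (1 + Real.log 2 * (κ - 2 * ∑ i, ((S.encode W (D i)).length : ℝ))) ≤
      ∑ _W : Library m F, 1 :=
    (Finset.sum_le_sum fun W _ => by
      rw [add_comm]
      exact Real.add_one_le_exp _).trans h1
  rw [Finset.sum_add_distrib, ← Finset.mul_sum] at h2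
  have h3 : ∑ W : Library m F, (κ - 2 * ∑ i, ((S.encode W (D i)).length : ℝ)) ≤ 0 := by
    by_contra! h
    nlinarith
  rw [← neg_nonpos, ← Finset.sum_neg_distrib]
  simpa using h3

end Counting

/-! ### The counting bound averaged over random requests -/

section Expectation

variable {n m L F cap t : ℕ}

theorem sum_pi_prod_mul {ι κ : Type} [Fintype ι] [DecidableEq ι] [Fintype κ] {p : κ → ℝ}
    (hp : ∑ y, p y = 1) (g : κ → ℝ) (i : ι) :
    ∑ x : ι → κ, (∏ j, p (x j)) * g (x i) = ∑ y, p y * g y := by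
  have h1 : ∀ x : ι → κ, (∏ j, p (x j)) * g (x i) =
      ∏ j, p (x j) * (if j = i then g (x j) else 1) := by
    intro x
    rw [Finset.prod_mul_distrib, Finset.prod_ite_eq' Finset.univ i fun j => g (x j)]
    simp
  simp only [h1]
  rw [sum_pi_prod fun j y => p y * (if j = i then g y else 1),
    ← Finset.mul_prod_erase _ _ (Finset.mem_univ i)]
  simp only [if_true]
  rw [Finset.prod_eq_one, mul_one]
  intro j hj
  simp [Finset.ne_of_mem_erase hj, hp]

/-- The expected number of different files requested by `U` in `t` independent rounds. -/
theorem sum_card_requestedFiles {q : Fin m → ℝ} (hq : ∑ f, q f = 1) (U : Finset (Fin n)) :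
    ∑ D : Fin t → Demand n m L, (∏ i, demandProb q (D i)) * ((requestedFiles U D).card : ℝ) =
      ∑ f, (1 - (1 - q f) ^ (L * U.card * t)) := by
  classical
  have hone : ∑ D : Fin t → Demand n m L, ∏ i, demandProb q (D i) = 1 := by
    rw [sum_pi_prod fun _ => demandProb q]
    simp [sum_demandProb hq]
  -- A file is missed when all `L * U.card * t` requests avoid it; written as a product, this
  -- indicator has an expectation that factorises.
  have h1 : ∀ D : Fin t → Demand n m L, ((requestedFiles U D).card : ℝ) =
      ∑ f, (1 - ∏ i, ∏ u, ∏ l, if u ∈ U ∧ D i u l = f then (0 : ℝ) else 1) := by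
    intro D
    rw [requestedFiles, Finset.card_filter, Nat.cast_sum]
    refine Finset.sum_congr rfl fun f _ => ?_
    split_ifs with h
    · obtain ⟨i, u, hu, l, hl⟩ := h
      rw [Finset.prod_eq_zero (Finset.mem_univ i), sub_zero, Nat.cast_one]
      rw [Finset.prod_eq_zero (Finset.mem_univ u)]
      rw [Finset.prod_eq_zero (Finset.mem_univ l)]
      simp [hu, hl]
    · push Not at h
      rw [Finset.prod_eq_one, sub_self, Nat.cast_zero]
      intro i _
      refine Finset.prod_eq_one fun u _ => Finset.prod_eq_one fun l _ => if_neg ?_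
      exact fun h' => h i u h'.1 l h'.2
  have h2 : ∀ f, ∑ D : Fin t → Demand n m L, (∏ i, demandProb q (D i)) *
      (∏ i, ∏ u, ∏ l, if u ∈ U ∧ D i u l = f then (0 : ℝ) else 1) =
      (1 - q f) ^ (L * U.card * t) := by
    intro f
    simp only [demandProb, ← Finset.prod_mul_distrib]
    rw [sum_pi_prod fun _ (d : Demand n m L) =>
      ∏ u, ∏ l, q (d u l) * (if u ∈ U ∧ d u l = f then (0 : ℝ) else 1)]
    rw [sum_demand_prod fun u _ x => q x * (if u ∈ U ∧ x = f then (0 : ℝ) else 1)]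
    have h3 : ∀ u : Fin n, ∑ x, q x * (if u ∈ U ∧ x = f then (0 : ℝ) else 1) =
        if u ∈ U then 1 - q f else 1 := by
      intro u
      split_ifs with hu
      · rw [← Finset.add_sum_erase _ _ (Finset.mem_univ f)]
        simp only [hu, true_and, if_true, mul_zero, zero_add]
        have h4 := Finset.add_sum_erase _ q (Finset.mem_univ f)
        rw [hq] at h4
        refine (Finset.sum_congr rfl fun x hx => ?_).trans (eq_sub_of_add_eq' h4)
        simp [Finset.ne_of_mem_erase hx]
      · simp [hu, hq]
    simp only [h3, Finset.prod_const, Finset.card_univ, Fintype.card_fin]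
    rw [Finset.prod_pow, Finset.prod_ite_mem, Finset.univ_inter, Finset.prod_const, ← pow_mul,
      ← pow_mul]
    ring_nf
  simp only [h1, Finset.mul_sum]
  rw [Finset.sum_comm]
  refine Finset.sum_congr rfl fun f _ => ?_
  simp only [mul_sub, mul_one, Finset.sum_sub_distrib]
  rw [hone, h2]

/-- The bound holds on average over libraries and over `t` independent request matrices, each with
the original distribution; some library is at least as bad as the average. -/
theorem CachingScheme.IsErrorFree.exists_length_ge {S : CachingScheme n m L F cap}
    (hS : S.IsErrorFree) {q : Fin m → ℝ} (hq0 : ∀ f, 0 ≤ q f) (hq : ∑ f, q f = 1)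
    (U : Finset (Fin n)) (t : ℕ) :
    ∃ W, (F : ℝ) * ∑ f, (1 - (1 - q f) ^ (L * U.card * t)) - U.card * cap - t ≤
      2 * t * ∑ d : Demand n m L, demandProb q d * ((S.encode W d).length : ℝ) := by
  have hone : ∑ D : Fin t → Demand n m L, ∏ i, demandProb q (D i) = 1 := by
    rw [sum_pi_prod fun _ => demandProb q]
    simp [sum_demandProb hq]
  have h1 : ∑ D : Fin t → Demand n m L, (∏ i, demandProb q (D i)) *
      ∑ _W : Library m F, ((F : ℝ) * (requestedFiles U D).card - U.card * cap - t) ≤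
      ∑ D : Fin t → Demand n m L, (∏ i, demandProb q (D i)) *
        ∑ W, 2 * ∑ i, ((S.encode W (D i)).length : ℝ) :=
    Finset.sum_le_sum fun D _ => mul_le_mul_of_nonneg_left (hS.sum_length_ge U D)
      (Finset.prod_nonneg fun i _ => demandProb_nonneg hq0 _)
  have h2 : ∑ D : Fin t → Demand n m L, (∏ i, demandProb q (D i)) *
      ∑ _W : Library m F, ((F : ℝ) * (requestedFiles U D).card - U.card * cap - t) =
      ∑ _W : Library m F,
        ((F : ℝ) * ∑ f, (1 - (1 - q f) ^ (L * U.card * t)) - U.card * cap - t) := by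
    simp only [Finset.mul_sum _ _ (_ : ℝ)]
    rw [Finset.sum_comm]
    refine Finset.sum_congr rfl fun W _ => ?_
    rw [← Finset.mul_sum, ← sum_card_requestedFiles hq U, Finset.mul_sum]
    rw [sub_sub, ← mul_one ((U.card : ℝ) * cap + t), ← hone, Finset.mul_sum,
      ← Finset.sum_sub_distrib]
    exact Finset.sum_congr rfl fun D _ => by ring
  have h3 : ∑ D : Fin t → Demand n m L, (∏ i, demandProb q (D i)) *
        ∑ W, 2 * ∑ i, ((S.encode W (D i)).length : ℝ) =
      ∑ W, 2 * t * ∑ d : Demand n m L, demandProb q d * ((S.encode W d).length : ℝ) := by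
    simp only [Finset.mul_sum _ (fun W : Library m F => (2 : ℝ) * _) (_ : ℝ)]
    rw [Finset.sum_comm]
    refine Finset.sum_congr rfl fun W _ => ?_
    calc _ = 2 * ∑ i, ∑ D : Fin t → Demand n m L, (∏ i, demandProb q (D i)) *
          ((S.encode W (D i)).length : ℝ) := by
          rw [Finset.sum_comm, Finset.mul_sum]
          refine Finset.sum_congr rfl fun D _ => ?_
          rw [← Finset.mul_sum]
          ring
      _ = 2 * ∑ _i : Fin t, ∑ d : Demand n m L,
          demandProb q d * ((S.encode W d).length : ℝ) := by
          congr 1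
          exact Finset.sum_congr rfl fun i _ =>
            sum_pi_prod_mul (sum_demandProb hq) (fun d => ((S.encode W d).length : ℝ)) i
      _ = _ := by
          rw [Finset.sum_const, Finset.card_univ, Fintype.card_fin, nsmul_eq_mul]
          ring
  rw [h2, h3] at h1
  obtain ⟨W, -, hW⟩ := Finset.exists_le_of_sum_le Finset.univ_nonempty h1
  exact ⟨W, hW⟩

/-- A single wrong decoding already costs the probability of its request matrix. These probabilities
are finitely many and positive for Zipf requests, so vanishing error means no error for large `F`.
-/
theorem isErrorFree_of_errorProb_lt {S : CachingScheme n m L F cap} {q : Fin m → ℝ}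
    (hq0 : ∀ f, 0 ≤ q f) (h : ∀ d : Demand n m L, S.errorProb q < demandProb q d) :
    S.IsErrorFree := by
  classical
  intro W d u
  by_contra hne
  refine (h d).not_ge ?_
  unfold CachingScheme.errorProb
  refine le_trans ?_ (le_ciSup (Set.finite_range _).bddAbove W)
  refine le_trans (le_of_eq ?_) (Finset.single_le_sum (fun d _ => ?_) (Finset.mem_univ d))
  · rw [if_pos ⟨u, hne⟩]
  · split_ifs
    · exact demandProb_nonneg hq0 d
    · exact le_rfl

/-- The cut-set bound, for the users in `U` and `t` rounds of transmission. -/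
theorem IsAchievable.cutset {M : ℝ} (hM : 0 ≤ M) {q : Fin m → ℝ} (hq0 : ∀ f, 0 < q f)
    (hq : ∑ f, q f = 1) {r : ℝ≥0∞} (hr : IsAchievable n m L M q r) (U : Finset (Fin n))
    (ht : 0 < t) :
    ENNReal.ofReal ((∑ f, (1 - (1 - q f) ^ (L * U.card * t)) - U.card * M) / (2 * t)) ≤ r := by
  obtain ⟨S, herr, hrate⟩ := hr
  refine le_trans ?_ hrate
  set G := ∑ f, (1 - (1 - q f) ^ (L * U.card * t))
  have ht' : (0 : ℝ) < t := by exact_mod_cast ht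
  have hev : ∀ᶠ F in atTop, ∀ d : Demand n m L, (S F).errorProb q < demandProb q d :=
    eventually_all.2 fun d => herr.eventually_lt_const (demandProb_pos hq0 d)
  have hle : ∀ᶠ F : ℕ in atTop,
      ENNReal.ofReal ((G - U.card * M - t / F) / (2 * t)) ≤ (S F).rate q := by
    filter_upwards [hev, eventually_gt_atTop 0] with F hF hF0
    have hF0' : (0 : ℝ) < F := by exact_mod_cast hF0
    obtain ⟨W, hW⟩ := (isErrorFree_of_errorProb_lt (fun f => (hq0 f).le) hF).exists_length_ge
      (fun f => (hq0 f).le) hq U t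
    refine le_trans (ENNReal.ofReal_le_ofReal ?_) (le_iSup (fun W => ENNReal.ofReal
      ((∑ d : Demand n m L, demandProb q d * (((S F).encode W d).length : ℝ)) / F)) W)
    have hcap : ((⌊M * F⌋₊ : ℕ) : ℝ) ≤ M * F := Nat.floor_le (by positivity)
    rw [div_le_div_iff₀ (by positivity) hF0']
    calc (G - U.card * M - t / F) * F = F * G - U.card * (M * F) - t := by
          field_simp
      _ ≤ F * G - U.card * (⌊M * F⌋₊ : ℕ) - t := by gcongr
      _ ≤ _ := hW
      _ = _ := by ring
  have hlim : Tendsto (fun F : ℕ => ENNReal.ofReal ((G - U.card * M - t / F) / (2 * t))) atTop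
      (𝓝 (ENNReal.ofReal ((G - U.card * M) / (2 * t)))) := by
    refine ENNReal.tendsto_ofReal (Tendsto.div_const ?_ _)
    simpa using (tendsto_const_div_atTop_nhds_zero_nat (t : ℝ)).const_sub (G - U.card * M)
  rw [← hlim.limsup_eq]
  exact limsup_le_limsup hle

end Expectation

/-! ## Order-optimality -/

section Order

/-- A discrete integral comparison: the increments of `x ^ (1 - α) / (1 - α)` dominate the terms, by
Bernoulli's inequality with exponent `1 - α ≤ 1`. -/
theorem sum_rpow_neg_le {α : ℝ} (hα0 : 0 < α) (hα1 : α < 1) (m : ℕ) :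
    ∑ i : Fin m, ((i : ℕ) + 1 : ℝ) ^ (-α) ≤ (m : ℝ) ^ (1 - α) / (1 - α) := by
  have hc : 0 < 1 - α := by linarith
  induction m with
  | zero => simp [Real.zero_rpow hc.ne']
  | succ m ih =>
    rw [Fin.sum_univ_castSucc]
    simp only [Fin.val_castSucc, Fin.val_last]
    have hm : (0 : ℝ) < m + 1 := by positivity
    have h1 : (m : ℝ) ^ (1 - α) ≤ (m + 1 : ℝ) ^ (1 - α) - (1 - α) * (m + 1 : ℝ) ^ (-α) := by
      have e1 : (m : ℝ) = (m + 1) * (1 + -(1 / (m + 1) : ℝ)) := by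
        field_simp
        ring
      have h2 : (1 : ℝ) / (m + 1) ≤ 1 := by
        rw [div_le_one hm]
        linarith [(Nat.cast_nonneg m : (0 : ℝ) ≤ m)]
      have h3 := rpow_one_add_le_one_add_mul_self (s := -(1 / (m + 1) : ℝ)) (by linarith) hc.le
        (by linarith : 1 - α ≤ 1)
      have e2 : (m + 1 : ℝ) ^ (1 - α) = (m + 1) * (m + 1 : ℝ) ^ (-α) := by
        rw [sub_eq_add_neg, Real.rpow_add hm, Real.rpow_one]
      calc (m : ℝ) ^ (1 - α) = (m + 1 : ℝ) ^ (1 - α) * (1 + -(1 / (m + 1) : ℝ)) ^ (1 - α) := by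
            rw [← Real.mul_rpow hm.le (by linarith), ← e1]
        _ ≤ (m + 1 : ℝ) ^ (1 - α) * (1 + (1 - α) * -(1 / (m + 1) : ℝ)) := by gcongr
        _ = _ := by
            rw [e2]
            field_simp
            ring
    have h2 : (m + 1 : ℝ) ^ (-α) ≤
        (m + 1 : ℝ) ^ (1 - α) / (1 - α) - (m : ℝ) ^ (1 - α) / (1 - α) := by
      rw [← sub_div, le_div_iff₀ hc]
      linarith
    push_cast
    linarith

/-- For `α < 1` even the least popular file has probability of the order of the uniform one; this is
where the converse uses the request distribution. -/
theorem zipf_ge {α : ℝ} (hα0 : 0 < α) (hα1 : α < 1) {m : ℕ} (f : Fin m) :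
    (1 - α) / m ≤ zipf α m f := by
  have hm : (0 : ℝ) < m := by exact_mod_cast f.pos
  have hc : 0 < 1 - α := by linarith
  have hs := zipf_sum_pos α f.pos
  unfold zipf
  rw [div_le_div_iff₀ hm hs]
  have h1 : (m : ℝ) ^ (-α) ≤ ((f : ℕ) + 1 : ℝ) ^ (-α) := by
    refine Real.rpow_le_rpow_of_nonpos (by positivity) ?_ (by linarith)
    exact_mod_cast f.isLt
  calc (1 - α) * ∑ i : Fin m, ((i : ℕ) + 1 : ℝ) ^ (-α)
      ≤ (1 - α) * ((m : ℝ) ^ (1 - α) / (1 - α)) := by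
        gcongr
        exact sum_rpow_neg_le hα0 hα1 m
    _ = (m : ℝ) ^ (-α) * m := by
        rw [mul_div_cancel₀ _ hc.ne', sub_eq_add_neg, add_comm, Real.rpow_add hm, Real.rpow_one]
    _ ≤ _ := by gcongr

theorem sum_hit_ge {α : ℝ} (hα0 : 0 < α) (hα1 : α < 1) {m : ℕ} (N : ℕ) :
    m * (1 - Real.exp (-((1 - α) / m * N))) ≤ ∑ f : Fin m, (1 - (1 - zipf α m f) ^ N) := by
  have h : ∀ f ∈ (Finset.univ : Finset (Fin m)),
      1 - Real.exp (-((1 - α) / m * N)) ≤ 1 - (1 - zipf α m f) ^ N := by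
    intro f _
    have h1 : zipf α m f ≤ 1 := by
      rw [← sum_zipf α f.pos]
      exact Finset.single_le_sum (fun g _ => (zipf_pos α g).le) (Finset.mem_univ f)
    have h2 : (1 - zipf α m f) ^ N ≤ Real.exp (-((1 - α) / m)) ^ N := by
      refine pow_le_pow_left₀ (by linarith) ?_ _
      have := Real.add_one_le_exp (-((1 - α) / m))
      have := zipf_ge hα0 hα1 f
      linarith
    rw [← Real.exp_nat_mul] at h2
    rw [show (N : ℝ) * -((1 - α) / m) = -((1 - α) / m * N) by ring] at h2
    linarith
  have := Finset.card_nsmul_le_sum _ _ _ h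
  simpa using this

/-- The ratio of the upper bound to the optimal rate. -/
noncomputable def gapConstant (α ε : ℝ) : ℝ :=
  4 / ε * (2 / (1 - ε) * (Real.log (2 / ε) / (1 - α)) + 1)

theorem one_le_gapConstant {α ε : ℝ} (hα1 : α < 1) (hε : 0 < ε) (hε1 : ε < 1) :
    1 ≤ gapConstant α ε := by
  unfold gapConstant
  have h1 : 1 ≤ 4 / ε := by
    rw [le_div_iff₀ hε]
    linarith
  have h2 : 0 ≤ Real.log (2 / ε) := by
    refine Real.log_nonneg ?_
    rw [le_div_iff₀ hε]
    linarith
  have h3 : 0 ≤ 2 / (1 - ε) * (Real.log (2 / ε) / (1 - α)) :=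
    mul_nonneg (div_nonneg (by norm_num) (by linarith)) (div_nonneg h2 (by linarith))
  nlinarith

theorem rateBound_le_gapConstant_mul {α ε : ℝ} (hα0 : 0 < α) (hα1 : α < 1) (hε : 0 < ε)
    (hε1 : ε < 1) {n m L : ℕ} (hn : 1 ≤ n) (hL : 1 ≤ L) {M : ℝ} (hM : 0 < M)
    (hMm : M ≤ (1 - ε) * m) :
    ENNReal.ofReal (rateBound n m L M) ≤
      ENNReal.ofReal (gapConstant α ε) * optimalRate n m L M (zipf α m) := by
  have hε' : 0 < 1 - ε := by linarith
  have hc : 0 < 1 - α := by linarith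
  have hm : (0 : ℝ) < m := by
    by_contra hcon
    nlinarith
  have hm' : 0 < m := by exact_mod_cast hm
  have hL' : (0 : ℝ) < L := by exact_mod_cast hL
  set κ := Real.log (2 / ε) / (1 - α) with hκ
  have hlog : 0 < Real.log (2 / ε) := by
    refine Real.log_pos ?_
    rw [lt_div_iff₀ hε]
    linarith
  have hκ0 : 0 < κ := by positivity
  set x := (1 - ε) * m / M with hx
  have hx1 : 1 ≤ x := by
    rw [hx, le_div_iff₀ hM]
    linarith
  -- As many users as possible whose caches together hold at most a fraction `1 - ε` of the library.
  set s := min n ⌊x⌋₊ with hs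
  have hs1 : 1 ≤ s := le_min hn ((Nat.one_le_floor_iff x).2 hx1)
  have hs' : (0 : ℝ) < s := by exact_mod_cast hs1
  have hsM : s * M ≤ (1 - ε) * m := by
    have : (s : ℝ) ≤ x :=
      le_trans (by exact_mod_cast min_le_right n ⌊x⌋₊) (Nat.floor_le (by linarith))
    rwa [hx, le_div_iff₀ hM] at this
  -- Enough rounds for `κ * m` requests in all; `κ` solves `exp (-(1 - α) * κ) = ε / 2`, the bound
  -- on the expected fraction of missed files.
  set t := ⌈κ * m / (s * L)⌉₊ with ht
  have ht0 : 0 < t := Nat.ceil_pos.2 (by positivity)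
  have ht' : (0 : ℝ) < t := by exact_mod_cast ht0
  obtain ⟨U, -, hU⟩ := Finset.exists_subset_card_eq
    (s := (Finset.univ : Finset (Fin n))) (n := s) (by simp [hs])
  have hN : κ * m ≤ (L * s * t : ℕ) := by
    have := Nat.le_ceil (κ * m / (s * L))
    rw [div_le_iff₀ (by positivity)] at this
    push_cast
    linarith
  have hhit : m * (1 - ε / 2) ≤ ∑ f : Fin m, (1 - (1 - zipf α m f) ^ (L * U.card * t)) := by
    rw [hU]
    refine le_trans ?_ (sum_hit_ge hα0 hα1 _)
    gcongr
    have h1 : Real.log (2 / ε) ≤ (1 - α) / m * (L * s * t : ℕ) := by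
      calc Real.log (2 / ε) = (1 - α) / m * (κ * m) := by
            rw [hκ]
            field_simp
        _ ≤ _ := by gcongr
    calc Real.exp (-((1 - α) / m * (L * s * t : ℕ))) ≤ Real.exp (-Real.log (2 / ε)) := by gcongr
      _ = ε / 2 := by
        rw [Real.exp_neg, Real.exp_log (by positivity), inv_div]
  have hopt : ENNReal.ofReal (ε / 2 * m / (2 * t)) ≤ optimalRate n m L M (zipf α m) := by
    refine le_sInf fun r hr => le_trans (ENNReal.ofReal_le_ofReal ?_)
      (IsAchievable.cutset hM.le (zipf_pos α) (sum_zipf α hm') hr U ht0)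
    gcongr
    rw [hU] at hhit ⊢
    linarith
  have htle : t * (s * L) ≤ κ * m + s * L := by
    have h1 : (t : ℝ) < κ * m / (s * L) + 1 := Nat.ceil_lt_add_one (by positivity)
    calc (t : ℝ) * (s * L) ≤ (κ * m / (s * L) + 1) * (s * L) := by gcongr
      _ = _ := by field_simp
  have hb1 : rateBound n m L M ≤ m := by
    refine (min_le_right _ _).trans ((min_le_right _ _).trans ?_)
    linarith
  have hb2 : rateBound n m L M ≤ 2 / (1 - ε) * (s * L) := by
    rcases le_total n ⌊x⌋₊ with h | h
    · have hsn : s = n := min_eq_left h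
      refine (min_le_right _ _).trans ((min_le_left _ _).trans ?_)
      rw [hsn, div_mul_eq_mul_div, le_div_iff₀ hε']
      have : (0 : ℝ) ≤ L * n := by positivity
      nlinarith
    · have hsx : s = ⌊x⌋₊ := min_eq_right h
      -- Since `⌊x⌋₊ ≥ 1`, rounding down loses at most a factor `2`.
      have hxs : x ≤ 2 * s := by
        have h1 := Nat.lt_floor_add_one x
        have h2 : (1 : ℝ) ≤ s := by exact_mod_cast hs1
        rw [← hsx] at h1
        linarith
      refine (min_le_left _ _).trans ?_
      calc (L : ℝ) * (m / M - 1) ≤ L * (m / M) := by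
            gcongr
            linarith
        _ = L * (x / (1 - ε)) := by
            rw [hx]
            field_simp
        _ ≤ L * (2 * s / (1 - ε)) := by gcongr
        _ = _ := by ring
  have hfin : rateBound n m L M ≤ gapConstant α ε * (ε / 2 * m / (2 * t)) := by
    -- Of the two terms bounding `t * (s * L)`, the main one is paired with `hb2` and the rounding
    -- term with `hb1`.
    have h1 : rateBound n m L M * t * (s * L) ≤ (2 / (1 - ε) * κ + 1) * m * (s * L) := by
      have hb0 : 0 ≤ rateBound n m L M := rateBound_nonneg hM (by nlinarith)
      calc rateBound n m L M * t * (s * L) = rateBound n m L M * (t * (s * L)) := by ring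
        _ ≤ rateBound n m L M * (κ * m + s * L) := by gcongr
        _ = rateBound n m L M * (κ * m) + rateBound n m L M * (s * L) := by ring
        _ ≤ 2 / (1 - ε) * (s * L) * (κ * m) + m * (s * L) := by gcongr
        _ = _ := by ring
    have h2 : rateBound n m L M * t ≤ (2 / (1 - ε) * κ + 1) * m :=
      le_of_mul_le_mul_right h1 (by positivity)
    have h3 : gapConstant α ε * (ε / 2 * m / (2 * t)) = (2 / (1 - ε) * κ + 1) * m / t := by
      unfold gapConstant
      rw [← hκ]
      field_simp
      ring
    rw [h3, le_div_iff₀ ht']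
    exact h2
  calc ENNReal.ofReal (rateBound n m L M)
      ≤ ENNReal.ofReal (gapConstant α ε * (ε / 2 * m / (2 * t))) := ENNReal.ofReal_le_ofReal hfin
    _ = ENNReal.ofReal (gapConstant α ε) * ENNReal.ofReal (ε / 2 * m / (2 * t)) :=
        ENNReal.ofReal_mul (zero_le_one.trans (one_le_gapConstant hα1 hε hε1))
    _ ≤ _ := by gcongr

end Order

end CodedCaching

open CodedCaching in
theorem theorem4 (α ε : ℝ) (hα0 : 0 < α) (hα1 : α < 1) (hε : 0 < ε) :
    -- UP-GCLC is a caching scheme without errors, of rate `gclcRate`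
    (∀ (n m L : ℕ) (M : ℝ) (o : ScanOrder n m L), 1 ≤ n → 1 ≤ L → 0 < M → M ≤ (1 - ε) * m →
      ∀ B : ℕ, 1 ≤ B → ∀ C : Placement n m M (uniformCaching m) B,
        ∀ᶠ k : ℕ in atTop, ∃ S : CachingScheme n m L (B * k) ⌊M * (B * k : ℕ)⌋₊,
          IsGCLCScheme o C.1 S ∧ S.errorProb (zipf α m) = 0 ∧
          S.rate (zipf α m) = ENNReal.ofReal (gclcRate o C.1 (zipf α m))) ∧
    -- the upper bound on its rate as `B → ∞`
    (∀ (n m L : ℕ) (M : ℝ) (o : ScanOrder n m L), 1 ≤ n → 1 ≤ L → 0 < M → M ≤ (1 - ε) * m →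
      RateAtMost o M (zipf α m) (uniformCaching m) (ENNReal.ofReal (rateBound n m L M))) ∧
    -- order-optimality of the rate and of the upper bound
    (∃ ν : ℝ, 1 ≤ ν ∧
      ∀ (n L : ℕ → ℕ) (M : ℕ → ℝ) (o : ∀ m, ScanOrder (n m) m (L m)),
        Tendsto n atTop atTop → (∀ m, 1 ≤ L m) →
        (∀ m : ℕ, 1 ≤ m → 0 < M m ∧ M m ≤ (1 - ε) * m) →
        limsup (fun m => upGclcRate (o m) (M m) (zipf α m) /
          optimalRate (n m) m (L m) (M m) (zipf α m)) atTop ≤ ENNReal.ofReal ν ∧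
        limsup (fun m => ENNReal.ofReal (rateBound (n m) m (L m) (M m)) /
          optimalRate (n m) m (L m) (M m) (zipf α m)) atTop ≤ ENNReal.ofReal ν) := by
  have hpos : ∀ {m : ℕ} {M : ℝ}, 0 < M → M ≤ (1 - ε) * m → 0 < m ∧ M ≤ m := by
    intro m M hM hMm
    have hle : M ≤ m := by
      have : (0 : ℝ) ≤ m := Nat.cast_nonneg m
      nlinarith
    exact ⟨by exact_mod_cast hM.trans_le hle, hle⟩
  have hupper : ∀ (n m L : ℕ) (M : ℝ) (o : ScanOrder n m L), 1 ≤ n → 1 ≤ L → 0 < M →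
      M ≤ (1 - ε) * m →
      RateAtMost o M (zipf α m) (uniformCaching m) (ENNReal.ofReal (rateBound n m L M)) := by
    intro n m L M o _ hL hM hMm
    obtain ⟨hm, hle⟩ := hpos hM hMm
    exact rateAtMost_rateBound hM hle hL (fun f => (zipf_pos α f).le) (sum_zipf α hm) o
  refine ⟨fun n m L M o _ _ hM hMm B hB C =>
    exists_isGCLCScheme hM (hpos hM hMm).1 hB (zipf α m) o C, hupper, ?_⟩
  rcases lt_or_ge ε 1 with hε1 | hε1
  · refine ⟨gapConstant α ε, one_le_gapConstant hα1 hε hε1, fun n L M o hn hL hM => ?_⟩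
    have hgap : ∀ᶠ m in atTop, ENNReal.ofReal (rateBound (n m) m (L m) (M m)) ≤
        ENNReal.ofReal (gapConstant α ε) * optimalRate (n m) m (L m) (M m) (zipf α m) := by
      filter_upwards [hn.eventually_ge_atTop 1, eventually_ge_atTop 1] with m hnm hm
      exact rateBound_le_gapConstant_mul hα0 hα1 hε hε1 hnm (hL m) (hM m hm).1 (hM m hm).2
    constructor
    · refine limsup_le_of_le (by isBoundedDefault) ?_
      filter_upwards [hgap, hn.eventually_ge_atTop 1, eventually_ge_atTop 1] with m hm hnm hm1
      exact ENNReal.div_le_of_le_mul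
        ((sInf_le (hupper _ _ _ _ (o m) hnm (hL m) (hM m hm1).1 (hM m hm1).2)).trans hm)
    · refine limsup_le_of_le (by isBoundedDefault) ?_
      filter_upwards [hgap] with m hm
      exact ENNReal.div_le_of_le_mul hm
  -- For `ε ≥ 1` the memory condition at `m = 1` reads `0 < M 1 ≤ 1 - ε ≤ 0`, so no such functions
  -- exist.
  · refine ⟨1, le_rfl, fun n L M o _ _ hM => ?_⟩
    obtain ⟨h1, h2⟩ := hM 1 le_rfl
    norm_num at h2
    linarith
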